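/- **Setting.** Let $(\mathcal V,\mathcal E)$ be a tree with buses $\mathcal V=\{0,\dots,n\}$, rooted at the substation $0$, lines oriented away from $0$, and let $\mathcal N(i)$ be the set of neighbours of $i$. Each line has an admittance $G_{ik}-\mathbf j B_{ik}$ (symmetric in $i,k$) with $B_{ik}>0$ and $G_{ik}=\kappa B_{ik}$ for a common $\kappa>0$. Buses $1,\dots,n$ have given net injections $p_i,q_i\in\mathbb R$. Put $$\tilde B_{ik}=(1+\kappa^2)B_{ik},\quad \tilde{\mathbf B}_i=\sum_{k\in\mathcal N(i)}\tilde B_{ik},\quad \tilde p_i=p_i-\kappa q_i,\quad \tilde q_i=q_i+\kappa p_i .$$ Let $s=(s_{ik})$ be the unique antisymmetric function on the lines with $\sum_{k\in\mathcal N(i)}\tilde B_{ik}s_{ik}=\tilde p_i$ for $i=1,\dots,n$. For $v\in\mathbb R^n_{>0}$ put $v_0=1$, and for $\theta\in\mathbb R^n$ put $\theta_0=0$. Call $v\in\mathbb R^n_{>0}$ admissible if $s_{ik}^2\le v_iv_k$ on every line. The *reduced power flow equations*, in the unknowns $v\in\mathbb R^n_{>0}$ and real $c_{ik}=c_{ki}$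 on the lines, are $$\tilde{\mathbf B}_iv_i-\sum_{k\in\mathcal N(i)}\tilde B_{ik}c_{ik}=\tilde q_i\ (1\le i\le n),\qquad s_{ik}^2+c_{ik}^2=v_iv_k\ ((i,k)\in\mathcal E).$$ * **Relaxation** (with arbitrary fixed weights $w_i>0$): maximize $\sum_i w_i\log v_i$ over the admissible $v$ with $\tilde{\mathbf B}_iv_i-\sum_{k\in\mathcal N(i)}\tilde B_{ik}\sqrt{v_iv_k-s_{ik}^2}\le\tilde q_i$ for $1\le i\le n$. It succeeds if there is a unique optimizer and all these inequalities are equalities there; it returns that $v$, with $s$ as above and $c_{ik}=\sqrt{v_iv_k-s_{ik}^2}$. * **Energy function**: minimize $$E(v,\theta)=\tfrac12\sum_{(i,k)\in\mathcal E}\tilde B_{ik}\bigl(v_i+v_k-2\sqrt{v_iv_k}\cos(\theta_i-\theta_k)\bigr)-\sum_{i=1}^n\tilde p_i\theta_i-\tfrac12\sum_{i=1}^n\tilde q_i\log v_i$$ over its convexity domain, the set of $(v,\theta)\in\mathbb R^n_{>0}\times\mathbb R^n$ with $|\theta_i-\theta_k|<\pi/2$ on every line and $$\sum_{i=1}^n2\tilde{\mathbf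 B}_iv_i\,e_ie_i^{\sf T}-\sum_{(i,k)\in\mathcal E}\tilde B_{ik}\frac{\sqrt{v_iv_k}}{\cos(\theta_i-\theta_k)}(e_i+e_k)(e_i+e_k)^{\sf T}\succeq0,$$ where $e_1,\dots,e_n$ are the unit vectors of $\mathbb R^n$ and $e_0=0$. It succeeds if there is a minimizer at which $\partial E/\partial\log v=0$ and $\partial E/\partial\theta=0$; it returns the $v$ of that minimizer, with $s_{ik}=\sqrt{v_iv_k}\sin(\theta_i-\theta_k)$ and $c_{ik}=\sqrt{v_iv_k}\cos(\theta_i-\theta_k)$. * **Fixed point**: iterate $v\leftarrow g(v)$, where $$g_i(v)=\frac{\tilde q_i}{\tilde{\mathbf B}_i}+\sum_{k\in\mathcal N(i)}\frac{\tilde B_{ik}}{\tilde{\mathbf B}_i}\sqrt{v_iv_k-s_{ik}^2}$$ for admissible $v$, from $v^{\max}=\mathbf 1+2L_{\rm red}^{-1}\tilde q$; here $L_{\rm red}$ is the Laplacian matrix with edge weights $\tilde B_{ik}$ without the row and column of bus $0$. It succeeds if all iterates are admissible and converge to an admissible $v$ with $g(v)=v$; it returns that $v$, with $s$ as above and $c_{ik}=\sqrt{v_iv_k-s_{ik}^2}$.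 **Theorem.** The following are equivalent: 1. the reduced power flow equations have a solution; 2. the relaxation, the energy function and the fixed-point approach all succeed. If these hold, all three approaches return the same $(v,s,c)$; it is a solution of the reduced power flow equations, and its $v$ is the maximal fixed point of $g$: it is componentwise at least every admissible fixed point of $g$. -/

import Mathlib

/-- A single-phase radial distribution network with buses `0, …, n` (bus `0` is the substation),
series admittances `G i k - 𝐣 B i k` on its lines, all with the same ratio `κ` of conductance to
susceptance, and specified net injections `p`, `q` at the buses `1, …, n`
(bus `i + 1` is represented by `i : Fin n`). Values of `G`, `B` off the lines are never used. -/
structure RadialNetwork (n : ℕ) where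
  graph : SimpleGraph (Fin (n + 1))
  isTree : graph.IsTree
  G : Fin (n + 1) → Fin (n + 1) → ℝ
  B : Fin (n + 1) → Fin (n + 1) → ℝ
  B_symm : ∀ i k, graph.Adj i k → B i k = B k i
  B_pos : ∀ i k, graph.Adj i k → 0 < B i k
  κ : ℝ
  κ_pos : 0 < κ
  G_eq : ∀ i k, graph.Adj i k → G i k = κ * B i k
  p : Fin n → ℝ
  q : Fin n → ℝ

/-- Squared voltage magnitudes `v` at the non-substation buses, and the line variables `s`, `c`
(indexed by ordered pairs of buses). -/
@[ext]
structure PowerFlowState (n : ℕ) where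
  v : Fin n → ℝ
  s : Fin (n + 1) → Fin (n + 1) → ℝ
  c : Fin (n + 1) → Fin (n + 1) → ℝ

namespace RadialNetwork

variable {n : ℕ} (N : RadialNetwork n)

/-! ### Reduced data -/

/-- The reduced line weight. -/
def Br (i k : Fin (n + 1)) : ℝ := (1 + N.κ ^ 2) * N.B i k

/-- The reduced active injection. -/
def pr (i : Fin n) : ℝ := N.p i - N.κ * N.q i

/-- The reduced reactive injection. -/
def qr (i : Fin n) : ℝ := N.q i + N.κ * N.p i

open Classical in
/-- The neighbours of a bus. -/
noncomputable def nbr (i : Fin (n + 1)) : Finset (Fin (n + 1)) :=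
  Finset.univ.filter fun k => N.graph.Adj i k

open Classical in
/-- The lines, oriented away from the substation. -/
noncomputable def lines : Finset (Fin (n + 1) × Fin (n + 1)) :=
  Finset.univ.filter fun e =>
    N.graph.Adj e.1 e.2 ∧ N.graph.dist 0 e.1 < N.graph.dist 0 e.2

/-- The total (reduced) susceptance incident to a bus. -/
noncomputable def Btot (i : Fin (n + 1)) : ℝ := ∑ k ∈ N.nbr i, N.Br i k

open Classical in
/-- The weighted Laplacian matrix of the network. -/
noncomputable def lap : Matrix (Fin (n + 1)) (Fin (n + 1)) ℝ :=
  fun i k => if i = k then N.Btot i else if N.graph.Adj i k then -N.Br i k else 0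

/-- The reduced Laplacian: the row and the column of the substation are deleted. -/
noncomputable def lapRed : Matrix (Fin n) (Fin n) ℝ :=
  N.lap.submatrix Fin.succ Fin.succ

open Classical in
/-- Restrict a function of ordered pairs of buses to the lines (zero elsewhere). -/
noncomputable def onLines (f : Fin (n + 1) → Fin (n + 1) → ℝ) : Fin (n + 1) → Fin (n + 1) → ℝ :=
  fun i k => if N.graph.Adj i k then f i k else 0

/-! ### The line flows `s(p)` -/

/-- `s` is a solution of the linear active power balance: it lives on the lines, is antisymmetric
(as `s i k = √(v i * v k) * sin (θ i - θ k)` is), and balances the reduced active injections. -/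
def IsLineFlow (s : Fin (n + 1) → Fin (n + 1) → ℝ) : Prop :=
  (∀ i k, s i k = -s k i) ∧ (∀ i k, ¬ N.graph.Adj i k → s i k = 0) ∧
    ∀ i : Fin n, ∑ k ∈ N.nbr i.succ, N.Br i.succ k * s i.succ k = N.pr i

theorem mem_nbr {i k : Fin (n + 1)} : k ∈ N.nbr i ↔ N.graph.Adj i k := by
  simp [nbr]

theorem Br_pos {i k : Fin (n + 1)} (h : N.graph.Adj i k) : 0 < N.Br i k := by
  have := N.B_pos i k h
  unfold Br
  positivity

/-- In a tree, the neighbour of a bus that is closer to the root is unique. -/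
theorem closer_unique {v u k : Fin (n + 1)} (hu : N.graph.Adj u v) (hk : N.graph.Adj k v)
    (du : N.graph.dist 0 u < N.graph.dist 0 v) (dk : N.graph.dist 0 k < N.graph.dist 0 v) :
    u = k := by
  have key : ∀ a, N.graph.Adj a v → N.graph.dist 0 a < N.graph.dist 0 v →
      ∃ p : N.graph.Walk 0 v, p.IsPath ∧ p.penultimate = a := by
    intro a ha da
    obtain ⟨p, hp, hl⟩ := N.isTree.connected.exists_path_of_dist 0 a
    have hv : v ∉ p.support := by
      intro hmem
      have h1 := SimpleGraph.dist_le (p.takeUntil v hmem)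
      have h2 := p.length_takeUntil_le_length hmem
      omega
    exact ⟨p.concat ha, hp.concat hv ha, by simp⟩
  obtain ⟨p, hp, rfl⟩ := key u hu du
  obtain ⟨p', hp', rfl⟩ := key k hk dk
  rw [(N.isTree.existsUnique_path 0 v).unique hp hp']

/-- The homogeneous active power balance has only the zero solution. -/
theorem flow_zero {s : Fin (n + 1) → Fin (n + 1) → ℝ} (hs : ∀ i k, s i k = -s k i)
    (h0 : ∀ i k, ¬ N.graph.Adj i k → s i k = 0)
    (hb : ∀ i : Fin n, ∑ k ∈ N.nbr i.succ, N.Br i.succ k * s i.succ k = 0) :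
    ∀ i k, s i k = 0 := by
  classical
  by_contra hne
  push Not at hne
  obtain ⟨i₀, k₀, hik⟩ := hne
  let S : Finset (Fin (n + 1)) := Finset.univ.filter fun v =>
    ∃ u, s v u ≠ 0 ∧ N.graph.dist 0 u < N.graph.dist 0 v
  have hadj : ∀ {a b}, s a b ≠ 0 → N.graph.Adj a b := fun {a b} h => by
    by_contra h'
    exact h (h0 a b h')
  have hS : S.Nonempty := by
    rcases lt_or_gt_of_ne (N.isTree.dist_ne_of_adj 0 (hadj hik)) with h | h
    · exact ⟨k₀, by
        simp only [S, Finset.mem_filter, Finset.mem_univ, true_and]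
        exact ⟨i₀, by rw [hs]; simpa using hik, h⟩⟩
    · exact ⟨i₀, by
        simp only [S, Finset.mem_filter, Finset.mem_univ, true_and]
        exact ⟨k₀, hik, h⟩⟩
  obtain ⟨v, hvS, hmax⟩ := S.exists_max_image (fun v => N.graph.dist 0 v) hS
  obtain ⟨u, hvu, hd⟩ : ∃ u, s v u ≠ 0 ∧ N.graph.dist 0 u < N.graph.dist 0 v := by
    simpa [S] using hvS
  have hv0 : v ≠ 0 := by
    rintro rfl
    simp at hd
  obtain ⟨i, rfl⟩ := Fin.exists_succ_eq.2 hv0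
  have hsum := hb i
  rw [Finset.sum_eq_single u] at hsum
  · rcases mul_eq_zero.1 hsum with h | h
    · exact (N.Br_pos (hadj hvu)).ne' h
    · exact hvu h
  · intro k hk hku
    have hk' := N.mem_nbr.1 hk
    by_contra hz
    have hz' : s i.succ k ≠ 0 := fun h => hz (by rw [h, mul_zero])
    rcases lt_or_gt_of_ne (N.isTree.dist_ne_of_adj 0 hk') with h | h
    · have := hmax k (by
        simp only [S, Finset.mem_filter, Finset.mem_univ, true_and]
        exact ⟨i.succ, by rw [hs]; simpa using hz', h⟩)
      omega
    · exact hku (N.closer_unique hk'.symm (hadj hvu).symm h hd)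
  · intro hu
    exact absurd (N.mem_nbr.2 (hadj hvu)) hu

/-- The active power balance is uniquely solvable for the line flows. -/
theorem existsUnique_lineFlow : ∃! s, N.IsLineFlow s := by
  classical
  let pot : (Fin n → ℝ) → Fin (n + 1) → Fin (n + 1) → ℝ := fun x i k =>
    if N.graph.Adj i k then (Fin.cons 0 x : Fin (n + 1) → ℝ) i - (Fin.cons 0 x : Fin (n + 1) → ℝ) k
    else 0
  have cons_add : ∀ (x y : Fin n → ℝ) (j : Fin (n + 1)), (Fin.cons 0 (x + y) : Fin (n + 1) → ℝ) j
      = (Fin.cons 0 x : Fin (n + 1) → ℝ) j + (Fin.cons 0 y : Fin (n + 1) → ℝ) j := by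
    intro x y j
    refine Fin.cases ?_ (fun i => ?_) j <;> simp
  have cons_smul : ∀ (a : ℝ) (x : Fin n → ℝ) (j : Fin (n + 1)),
      (Fin.cons 0 (a • x) : Fin (n + 1) → ℝ) j = a * (Fin.cons 0 x : Fin (n + 1) → ℝ) j := by
    intro a x j
    refine Fin.cases ?_ (fun i => ?_) j <;> simp
  have pot_anti : ∀ x i k, pot x i k = -pot x k i := by
    intro x i k
    simp only [pot, N.graph.adj_comm k i]
    split_ifs <;> simp
  have pot_off : ∀ x i k, ¬ N.graph.Adj i k → pot x i k = 0 := by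
    intro x i k h
    simp [pot, h]
  let T : (Fin n → ℝ) →ₗ[ℝ] (Fin n → ℝ) :=
    { toFun := fun x i => ∑ k ∈ N.nbr i.succ, N.Br i.succ k * pot x i.succ k
      map_add' := by
        intro x y
        ext i
        simp only [Pi.add_apply, ← Finset.sum_add_distrib]
        refine Finset.sum_congr rfl fun k _ => ?_
        simp only [pot, cons_add]
        split_ifs <;> ring
      map_smul' := by
        intro a x
        ext i
        simp only [Pi.smul_apply, smul_eq_mul, RingHom.id_apply, Finset.mul_sum]
        refine Finset.sum_congr rfl fun k _ => ?_
        simp only [pot, cons_smul]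
        split_ifs <;> ring }
  have hinj : Function.Injective T := by
    rw [injective_iff_map_eq_zero]
    intro x hx
    have h0 := N.flow_zero (pot_anti x) (pot_off x) (fun i => congrFun hx i)
    have hconst : ∀ {a b : Fin (n + 1)} (_ : N.graph.Walk a b),
        (Fin.cons 0 x : Fin (n + 1) → ℝ) a = (Fin.cons 0 x : Fin (n + 1) → ℝ) b := by
      intro a b w
      induction w with
      | nil => rfl
      | @cons a b _ h _ ih =>
        rw [← ih]
        have h1 := h0 a b
        simp only [pot] at h1
        rw [if_pos h] at h1
        exact sub_eq_zero.1 h1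
    ext i
    obtain ⟨w⟩ := N.isTree.connected.preconnected i.succ 0
    simpa using hconst w
  obtain ⟨x, hx⟩ := (LinearMap.injective_iff_surjective.1 hinj) N.pr
  refine ⟨pot x, ⟨pot_anti x, pot_off x, fun i => congrFun hx i⟩, ?_⟩
  intro s ⟨h1, h2, h3⟩
  have hz := N.flow_zero (s := fun i k => s i k - pot x i k)
    (fun i k => by rw [h1 i k, pot_anti x i k]; ring)
    (fun i k h => by rw [h2 i k h, pot_off x i k h]; ring)
    (fun i => by
      have h4 : ∑ k ∈ N.nbr i.succ, N.Br i.succ k * pot x i.succ k = N.pr i := congrFun hx i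
      simp only [mul_sub, Finset.sum_sub_distrib, h3 i, h4, sub_self])
  funext i k
  exact sub_eq_zero.1 (hz i k)

/-- The line flows determined by the active injections. -/
noncomputable def flow : Fin (n + 1) → Fin (n + 1) → ℝ :=
  N.existsUnique_lineFlow.choose

/-! ### Power flow equations -/

/-- Squared voltage magnitudes at all buses; the substation has `v 0 = 1`. -/
def withSlack (v : Fin n → ℝ) : Fin (n + 1) → ℝ := Fin.cons 1 v

/-- Voltage phases at all buses; the substation has `θ 0 = 0`. -/
def withSlackPhase (θ : Fin n → ℝ) : Fin (n + 1) → ℝ := Fin.cons 0 θ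

/-- `x` solves the reduced power flow equations in the unknowns `v > 0` and `c`, the line
variables `s` being the flows `s(p)`. -/
def IsPowerFlowSolution (x : PowerFlowState n) : Prop :=
  (∀ i, 0 < x.v i) ∧ x.s = N.flow ∧
  (∀ i k, x.c i k = x.c k i) ∧ (∀ i k, ¬ N.graph.Adj i k → x.c i k = 0) ∧
  (∀ i : Fin n, N.Btot i.succ * x.v i - ∑ k ∈ N.nbr i.succ, N.Br i.succ k * x.c i.succ k
    = N.qr i) ∧
  ∀ i k, N.graph.Adj i k →
    N.flow i k ^ 2 + x.c i k ^ 2 = withSlack x.v i * withSlack x.v k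

/-- Positive `v` for which all the square roots `√(v i * v k - s i k ^ 2)` are real. -/
def Admissible (v : Fin n → ℝ) : Prop :=
  (∀ i, 0 < v i) ∧
  ∀ i k, N.graph.Adj i k → N.flow i k ^ 2 ≤ withSlack v i * withSlack v k

/-- The left-hand side of the power flow equations after elimination of `c`. -/
noncomputable def balance (v : Fin n → ℝ) (i : Fin n) : ℝ :=
  N.Btot i.succ * v i - ∑ k ∈ N.nbr i.succ,
    N.Br i.succ k * √(withSlack v i.succ * withSlack v k - N.flow i.succ k ^ 2)

/-- The state computed from `v` with `s = s(p)` and `c i k = √(v i * v k - s i k ^ 2)`. -/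
noncomputable def stateOf (v : Fin n → ℝ) : PowerFlowState n where
  v := v
  s := N.flow
  c := N.onLines fun i k => √(withSlack v i * withSlack v k - N.flow i k ^ 2)

/-! ### Convex relaxation approach -/

/-- The feasible set of the relaxation. -/
def relaxFeasible : Set (Fin n → ℝ) :=
  {v | N.Admissible v ∧ ∀ i, N.balance v i ≤ N.qr i}

/-- `v` maximizes `∑ w i * log (v i)` over the feasible set. -/
def IsRelaxOptimal (w v : Fin n → ℝ) : Prop :=
  v ∈ N.relaxFeasible ∧ IsMaxOn (fun u => ∑ i, w i * Real.log (u i)) N.relaxFeasible v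

/-- The relaxation approach succeeds with result `x`: `x.v` is the optimal solution (in
particular the only one) and satisfies the constraints with equality. -/
def RelaxationComputes (w : Fin n → ℝ) (x : PowerFlowState n) : Prop :=
  N.IsRelaxOptimal w x.v ∧ (∀ u, N.IsRelaxOptimal w u → u = x.v) ∧
  (∀ i, N.balance x.v i = N.qr i) ∧ x = N.stateOf x.v

def RelaxationSucceeds (w : Fin n → ℝ) : Prop := ∃ x, N.RelaxationComputes w x

/-! ### Energy function approach -/

/-- The energy function. -/
noncomputable def energy (v θ : Fin n → ℝ) : ℝ :=
  1 / 2 * ∑ e ∈ N.lines, N.Br e.1 e.2 *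
      (withSlack v e.1 + withSlack v e.2 - 2 * √(withSlack v e.1 * withSlack v e.2) *
        Real.cos (withSlackPhase θ e.1 - withSlackPhase θ e.2))
    - ∑ i, N.pr i * θ i - ∑ i, N.qr i * Real.log (v i) / 2

/-- The unit vector of bus `j` in `ℝⁿ`; it is zero for the substation. -/
def unitVec (j : Fin (n + 1)) : Fin n → ℝ := fun i => if j = i.succ then 1 else 0

/-- The matrix of the convexity condition. The rank-one matrix of the line `(i, k)` has the
entries `1 1; 1 1` in the rows and columns `i, k`, and `√(v i * v k) / cos (θ i - θ k)` is
`v i * v k / c i k`. -/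
noncomputable def convexityMatrix (v θ : Fin n → ℝ) : Matrix (Fin n) (Fin n) ℝ :=
  Matrix.diagonal (fun i : Fin n => N.Btot i.succ * (2 * v i)) -
    ∑ e ∈ N.lines,
      (N.Br e.1 e.2 * √(withSlack v e.1 * withSlack v e.2) /
        Real.cos (withSlackPhase θ e.1 - withSlackPhase θ e.2)) •
      Matrix.vecMulVec (unitVec e.1 + unitVec e.2) (unitVec e.1 + unitVec e.2 : Fin n → ℝ)

/-- The convexity domain of the energy function. The phase differences over the lines lie in
`(-π/2, π/2)`, so that `c i k = √(v i * v k) * cos (θ i - θ k) > 0`. -/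
def convexityDomain : Set ((Fin n → ℝ) × (Fin n → ℝ)) :=
  {z | (∀ i, 0 < z.1 i) ∧ (N.convexityMatrix z.1 z.2).PosSemidef ∧
    ∀ e ∈ N.lines, |withSlackPhase z.2 e.1 - withSlackPhase z.2 e.2| < Real.pi / 2}

/-- The derivative of the energy in the variables `(log v, θ)` vanishes at `(v, θ)`. -/
def IsEnergyStationary (v θ : Fin n → ℝ) : Prop :=
  HasFDerivAt
    (fun z : (Fin n → ℝ) × (Fin n → ℝ) => N.energy (fun i => Real.exp (z.1 i)) z.2)
    (0 : (Fin n → ℝ) × (Fin n → ℝ) →L[ℝ] ℝ) (fun i => Real.log (v i), θ)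

/-- The energy function approach succeeds with result `x`. -/
def EnergyComputes (x : PowerFlowState n) : Prop :=
  ∃ θ : Fin n → ℝ, (x.v, θ) ∈ N.convexityDomain ∧
    IsMinOn (fun z => N.energy z.1 z.2) N.convexityDomain (x.v, θ) ∧
    N.IsEnergyStationary x.v θ ∧
    x.s = N.onLines (fun i k => √(withSlack x.v i * withSlack x.v k) *
      Real.sin (withSlackPhase θ i - withSlackPhase θ k)) ∧
    x.c = N.onLines (fun i k => √(withSlack x.v i * withSlack x.v k) *
      Real.cos (withSlackPhase θ i - withSlackPhase θ k))

def EnergySucceeds : Prop := ∃ x, N.EnergyComputes x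

/-! ### Fixed-point approach -/

/-- The fixed-point map (meaningful at admissible `v`). -/
noncomputable def g (v : Fin n → ℝ) (i : Fin n) : ℝ :=
  N.qr i / N.Btot i.succ + ∑ k ∈ N.nbr i.succ, N.Br i.succ k / N.Btot i.succ *
    √(withSlack v i.succ * withSlack v k - N.flow i.succ k ^ 2)

/-- The fixed points of `g` in its domain. -/
def fixedPoints : Set (Fin n → ℝ) := {v | N.Admissible v ∧ N.g v = v}

/-- The starting point `1 + 2 L_red⁻¹ q` of the iteration. -/
noncomputable def vmax : Fin n → ℝ := fun i => 1 + 2 * (N.lapRed⁻¹.mulVec N.qr) i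

/-- The fixed-point approach succeeds with result `x`: the iteration never leaves the domain of
`g` and converges to a fixed point of `g` there. -/
def FixedPointComputes (x : PowerFlowState n) : Prop :=
  (∀ m : ℕ, N.Admissible (N.g^[m] N.vmax)) ∧
  Filter.Tendsto (fun m : ℕ => N.g^[m] N.vmax) Filter.atTop (nhds x.v) ∧
  x.v ∈ N.fixedPoints ∧ x = N.stateOf x.v

def FixedPointSucceeds : Prop := ∃ x, N.FixedPointComputes x

end RadialNetwork

namespace RadialNetwork

variable {n : ℕ} (N : RadialNetwork n)

/-! All three approaches are compared with one point: the greatest element `v` of the feasible set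
of the relaxation. Feasibility means `u ≤ g u` (`balance_le_iff`), and `g` is monotone and
continuous. The AM-GM inequality and the minimum principle for the Laplacian put every feasible
point below `vmax` and give `g vmax ≤ vmax`. So, as soon as a feasible point exists, the iteration
decreases to a fixed point that dominates all feasible points (`exists_isGreatest`). Every power
flow solution is feasible, whatever the signs of its `c`, and every fixed point is a solution. The
objective of the relaxation is strictly increasing in each coordinate, so `v` is its unique
optimizer.

For the energy, stationarity in `(log v, θ)` is the power flow system with `c = √(v i * v k) * cos
(θ i - θ k)`, and the convexity matrix is twice the Jacobian of the balance in `log v`. At the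
greatest point no `c` vanishes (`line_slack_pos`), since otherwise raising the ends of the tight
line stays feasible. The convexity matrix is semidefinite there (`IsCompatible.posSemidef`), since
otherwise a nonnegative eigenvector with negative eigenvalue is a feasible direction. With phases
from `arcsin`, `v` is thus a stationary point in the convexity domain. In logarithmic variables this
domain and the energy on it are convex, so the point is a minimizer (`isMinOn_energy`).

Conversely, a stationary point in the domain is a fixed point `u ≤ v`. Semidefiniteness at `u` and
the tangent bound for the square roots force `u = v` (`IsCompatible.eq_of_posSemidef`). -/

@[simp] theorem withSlack_zero (v : Fin n → ℝ) : withSlack v 0 = 1 := rfl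

@[simp] theorem withSlack_succ (v : Fin n → ℝ) (i : Fin n) : withSlack v i.succ = v i := rfl

@[simp] theorem withSlackPhase_zero (x : Fin n → ℝ) : withSlackPhase x 0 = 0 := rfl

@[simp] theorem withSlackPhase_succ (x : Fin n → ℝ) (i : Fin n) :
    withSlackPhase x i.succ = x i := rfl

theorem withSlack_pos {v : Fin n → ℝ} (hv : ∀ i, 0 < v i) (j : Fin (n + 1)) :
    0 < withSlack v j := by
  refine Fin.cases ?_ (fun i => ?_) j
  · simp
  · simpa using hv i

theorem withSlack_mono {u v : Fin n → ℝ} (h : u ≤ v) (j : Fin (n + 1)) :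
    withSlack u j ≤ withSlack v j := by
  refine Fin.cases ?_ (fun i => ?_) j
  · simp
  · simpa using h i

theorem Br_symm {i k : Fin (n + 1)} (h : N.graph.Adj i k) : N.Br i k = N.Br k i := by
  simp [Br, N.B_symm i k h]

theorem flow_spec : N.IsLineFlow N.flow := N.existsUnique_lineFlow.choose_spec.1

theorem flow_unique {s : Fin (n + 1) → Fin (n + 1) → ℝ} (hs : N.IsLineFlow s) : s = N.flow :=
  N.existsUnique_lineFlow.unique hs N.flow_spec

theorem flow_antisymm (i k : Fin (n + 1)) : N.flow i k = -N.flow k i := N.flow_spec.1 i k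

theorem flow_sq_symm (i k : Fin (n + 1)) : N.flow i k ^ 2 = N.flow k i ^ 2 := by
  rw [N.flow_antisymm i k, neg_sq]

/-! ### The tree and its Laplacian -/

theorem exists_closer {i : Fin (n + 1)} (hi : i ≠ 0) :
    ∃ k, N.graph.Adj i k ∧ N.graph.dist 0 k < N.graph.dist 0 i := by
  obtain ⟨w, hw⟩ := N.isTree.connected.exists_walk_length_eq_dist i 0
  cases w with
  | nil => exact absurd rfl hi
  | @cons _ b _ h p =>
    refine ⟨b, h, ?_⟩
    rw [SimpleGraph.dist_comm (u := 0) (v := b), SimpleGraph.dist_comm (u := 0) (v := i), ← hw]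
    exact lt_of_le_of_lt (SimpleGraph.dist_le p) (by simp)

theorem Btot_pos (i : Fin n) : 0 < N.Btot i.succ := by
  obtain ⟨k, hk, -⟩ := N.exists_closer (Fin.succ_ne_zero i)
  exact Finset.sum_pos (fun k hk => N.Br_pos (N.mem_nbr.1 hk)) ⟨k, N.mem_nbr.2 hk⟩

/-- A function that is constant along the lines is constant. -/
theorem eq_zero_of_adj_eq {X : Fin (n + 1) → ℝ} (h0 : X 0 = 0)
    (h : ∀ i k, N.graph.Adj i k → X i = X k) (j : Fin (n + 1)) : X j = 0 := by
  have key : ∀ {a b : Fin (n + 1)}, N.graph.Walk a b → X a = X b := by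
    intro a b w
    induction w with
    | nil => rfl
    | cons hadj _ ih => rw [h _ _ hadj, ih]
  obtain ⟨w⟩ := N.isTree.connected.preconnected j 0
  rw [key w, h0]

theorem lapRed_mulVec (x : Fin n → ℝ) (i : Fin n) :
    N.lapRed.mulVec x i = ∑ k ∈ N.nbr i.succ, N.Br i.succ k *
      (withSlackPhase x i.succ - withSlackPhase x k) := by
  classical
  have h1 : N.lapRed.mulVec x i = ∑ k, N.lap i.succ k * withSlackPhase x k := by
    rw [Fin.sum_univ_succ]
    simp [Matrix.mulVec, dotProduct, lapRed]
  have h2 : ∀ k, N.lap i.succ k * withSlackPhase x k =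
      (if i.succ = k then N.Btot i.succ * withSlackPhase x k else 0) -
      (if N.graph.Adj i.succ k then N.Br i.succ k * withSlackPhase x k else 0) := by
    intro k
    unfold lap
    by_cases h : i.succ = k
    · subst h; simp
    · by_cases h' : N.graph.Adj i.succ k <;> simp [h, h']
  rw [h1, Finset.sum_congr rfl fun k _ => h2 k, Finset.sum_sub_distrib, Finset.sum_ite_eq,
    if_pos (Finset.mem_univ _), ← Finset.sum_filter]
  simp only [mul_sub, Finset.sum_sub_distrib, ← Finset.sum_mul]
  rfl

/-- The minimum principle for the Laplacian. -/
theorem nonneg_of_lap_nonneg {X : Fin (n + 1) → ℝ} (h0 : 0 ≤ X 0)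
    (h : ∀ i : Fin n, 0 ≤ ∑ k ∈ N.nbr i.succ, N.Br i.succ k * (X i.succ - X k)) :
    ∀ j, 0 ≤ X j := by
  classical
  obtain ⟨m, -, hm⟩ := Finset.exists_min_image Finset.univ X ⟨0, Finset.mem_univ _⟩
  -- Among the minimizers of `X` take one nearest to the root. If it were not the root, all its
  -- neighbours would be minimizers too, including a closer one.
  obtain ⟨j, hj, hjmin⟩ := Finset.exists_min_image
    (Finset.univ.filter fun j => X j = X m) (fun j => N.graph.dist 0 j) ⟨m, by simp⟩
  have hjm : X j = X m := by simpa using hj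
  have hmin : ∀ k, X j ≤ X k := fun k => hjm ▸ hm k (Finset.mem_univ _)
  by_cases hj0 : j = 0
  · subst hj0
    exact fun k => h0.trans (hmin k)
  · exfalso
    obtain ⟨k, hk, hd⟩ := N.exists_closer hj0
    obtain ⟨i, rfl⟩ := Fin.exists_succ_eq.2 hj0
    have hle : ∀ k ∈ N.nbr i.succ, N.Br i.succ k * (X i.succ - X k) ≤ 0 := fun k hk =>
      mul_nonpos_of_nonneg_of_nonpos (N.Br_pos (N.mem_nbr.1 hk)).le (sub_nonpos.2 (hmin k))
    have hz := (Finset.sum_eq_zero_iff_of_nonpos hle).1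
      (le_antisymm (Finset.sum_nonpos hle) (h i)) k (N.mem_nbr.2 hk)
    have hXk : X k = X m := by
      rcases mul_eq_zero.1 hz with h | h
      · exact absurd h (N.Br_pos hk).ne'
      · linarith
    have := hjmin k (by simpa using hXk)
    omega

/-- The minimum principle for both `x - y` and `y - x` gives injectivity. -/
theorem isUnit_lapRed : IsUnit N.lapRed := by
  rw [← Matrix.mulVec_injective_iff_isUnit]
  have key : ∀ x, N.lapRed.mulVec x = 0 → ∀ i, 0 ≤ x i := by
    intro x hx i
    have := N.nonneg_of_lap_nonneg (X := withSlackPhase x) le_rfl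
      (fun i => by rw [← lapRed_mulVec, hx]; rfl) i.succ
    simpa using this
  intro x y hxy
  have hxy' : N.lapRed.mulVec x = N.lapRed.mulVec y := hxy
  funext i
  have h1 := key (x - y) (by rw [Matrix.mulVec_sub, hxy', sub_self]) i
  have h2 := key (y - x) (by rw [Matrix.mulVec_sub, hxy', sub_self]) i
  simp only [Pi.sub_apply] at h1 h2
  linarith

theorem lapRed_mulVec_inv (b : Fin n → ℝ) : N.lapRed.mulVec (N.lapRed⁻¹.mulVec b) = b := by
  rw [Matrix.mulVec_mulVec, Matrix.mul_nonsing_inv _ ((Matrix.isUnit_iff_isUnit_det _).1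
    N.isUnit_lapRed), Matrix.one_mulVec]

/-- On a tree every antisymmetric function of the lines is a difference of potentials. -/
theorem exists_potential {d : Fin (n + 1) → Fin (n + 1) → ℝ}
    (hd : ∀ i k, N.graph.Adj i k → d i k = -d k i) :
    ∃ x : Fin n → ℝ, ∀ i k, N.graph.Adj i k → withSlackPhase x i - withSlackPhase x k = d i k := by
  classical
  -- The potential solves the Laplace equation whose right-hand side is the weighted divergence of
  -- `d`. The defect is then an antisymmetric flow with zero balance, and a tree carries no such
  -- flow except zero.
  set b : Fin n → ℝ := fun i => ∑ k ∈ N.nbr i.succ, N.Br i.succ k * d i.succ k with hb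
  refine ⟨N.lapRed⁻¹.mulVec b, fun i k hik => ?_⟩
  set x := N.lapRed⁻¹.mulVec b
  have hz := N.flow_zero
    (s := N.onLines fun i k => withSlackPhase x i - withSlackPhase x k - d i k)
    (fun i k => by
      by_cases h : N.graph.Adj i k
      · simp only [onLines, if_pos h, if_pos h.symm, hd i k h]; ring
      · simp [onLines, h, mt SimpleGraph.Adj.symm h])
    (fun i k h => by simp [onLines, h])
    (fun i => by
      have h1 := congrFun (N.lapRed_mulVec_inv b) i
      rw [lapRed_mulVec, hb, ← sub_eq_zero, ← Finset.sum_sub_distrib] at h1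
      rw [← h1]
      refine Finset.sum_congr rfl fun k hk => ?_
      rw [onLines, if_pos (N.mem_nbr.1 hk)]
      ring) i k
  rw [onLines, if_pos hik] at hz
  linarith

theorem mem_lines {e : Fin (n + 1) × Fin (n + 1)} :
    e ∈ N.lines ↔ N.graph.Adj e.1 e.2 ∧ N.graph.dist 0 e.1 < N.graph.dist 0 e.2 := by
  simp [lines]

theorem adj_iff_mem_lines {i k : Fin (n + 1)} :
    N.graph.Adj i k ↔ (i, k) ∈ N.lines ∨ (k, i) ∈ N.lines := by
  simp only [mem_lines]
  constructor
  · intro h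
    rcases lt_or_gt_of_ne (N.isTree.dist_ne_of_adj 0 h) with h' | h'
    · exact Or.inl ⟨h, h'⟩
    · exact Or.inr ⟨h.symm, h'⟩
  · rintro (h | h)
    · exact h.1
    · exact h.1.symm

/-- Summation over the lines by buses. -/
theorem sum_lines (f : Fin (n + 1) → Fin (n + 1) → ℝ) :
    ∑ e ∈ N.lines, (f e.1 e.2 + f e.2 e.1) = ∑ i, ∑ k ∈ N.nbr i, f i k := by
  classical
  have h1 : ∑ i, ∑ k ∈ N.nbr i, f i k =
      ∑ e ∈ Finset.univ.filter (fun e : Fin (n + 1) × Fin (n + 1) => N.graph.Adj e.1 e.2),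
        f e.1 e.2 := by
    rw [Finset.sum_filter, Fintype.sum_prod_type]
    refine Finset.sum_congr rfl fun i _ => ?_
    rw [← Finset.sum_filter]
    rfl
  have h2 : Finset.univ.filter (fun e : Fin (n + 1) × Fin (n + 1) => N.graph.Adj e.1 e.2) =
      N.lines ∪ N.lines.map (Equiv.prodComm _ _).toEmbedding := by
    ext ⟨i, k⟩
    simp [N.adj_iff_mem_lines]
  have h3 : Disjoint N.lines (N.lines.map (Equiv.prodComm _ _).toEmbedding) := by
    rw [Finset.disjoint_left]
    rintro ⟨i, k⟩ h h'
    have h'' : (k, i) ∈ N.lines := by simpa using h'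
    have a := (N.mem_lines.1 h).2
    have b := (N.mem_lines.1 h'').2
    simp only at a b
    omega
  rw [h1, h2, Finset.sum_union h3, Finset.sum_map, Finset.sum_add_distrib]
  rfl

/-- This is the summation by parts behind the quadratic form, the slope and the curvature. Test
vectors extended by zero to the substation satisfy `hf`. -/
theorem sum_lines_of_slack {f : Fin (n + 1) → Fin (n + 1) → ℝ} (hf : ∀ k, f 0 k = 0) :
    ∑ e ∈ N.lines, (f e.1 e.2 + f e.2 e.1) = ∑ i : Fin n, ∑ k ∈ N.nbr i.succ, f i.succ k := by
  rw [sum_lines, Fin.sum_univ_succ, Finset.sum_eq_zero fun k _ => hf k, zero_add]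

/-! ### Monotonicity of the fixed-point map -/

theorem sqrt_mul_sub_sq_le {x y : ℝ} (hx : 0 ≤ x) (hy : 0 ≤ y) (s : ℝ) :
    √(x * y - s ^ 2) ≤ (x + y) / 2 := by
  refine Real.sqrt_le_iff.2 ⟨by positivity, ?_⟩
  nlinarith [sq_nonneg (x - y), sq_nonneg s]

theorem Btot_mul_g (v : Fin n → ℝ) (i : Fin n) :
    N.Btot i.succ * N.g v i = N.qr i + ∑ k ∈ N.nbr i.succ,
      N.Br i.succ k * √(withSlack v i.succ * withSlack v k - N.flow i.succ k ^ 2) := by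
  have := (N.Btot_pos i).ne'
  unfold g
  rw [mul_add, Finset.mul_sum]
  congr 1
  · field_simp
  · refine Finset.sum_congr rfl fun k _ => ?_
    field_simp

theorem balance_eq (v : Fin n → ℝ) (i : Fin n) :
    N.balance v i = N.qr i + N.Btot i.succ * (v i - N.g v i) := by
  rw [mul_sub, Btot_mul_g, balance]
  ring

/-- The balance exceeds `qr i` by `Btot * (v i - g v i)`, and the factor is positive. Feasible
points are therefore the admissible subsolutions of `g`. -/
theorem balance_le_iff (v : Fin n → ℝ) (i : Fin n) :
    N.balance v i ≤ N.qr i ↔ v i ≤ N.g v i := by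
  have := N.Btot_pos i
  rw [balance_eq]
  constructor
  · intro h
    by_contra! h'
    nlinarith [mul_pos this (sub_pos.2 h')]
  · intro h
    nlinarith [mul_nonneg this.le (sub_nonneg.2 h)]

theorem balance_eq_iff (v : Fin n → ℝ) (i : Fin n) :
    N.balance v i = N.qr i ↔ N.g v i = v i := by
  have := (N.Btot_pos i).ne'
  rw [balance_eq, add_eq_left, mul_eq_zero, or_iff_right this, sub_eq_zero, eq_comm]

theorem fixedPoints_iff {v : Fin n → ℝ} :
    v ∈ N.fixedPoints ↔ N.Admissible v ∧ ∀ i, N.balance v i = N.qr i := by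
  simp only [fixedPoints, Set.mem_ofPred_eq, funext_iff, balance_eq_iff]

theorem fixedPoints_subset : N.fixedPoints ⊆ N.relaxFeasible := fun _ hv =>
  ⟨hv.1, fun i => ((N.fixedPoints_iff.1 hv).2 i).le⟩

variable {N}

/-- The domain of `g` is upward closed, so iterates that stay above a feasible point never leave it.
-/
theorem Admissible.mono {u v : Fin n → ℝ} (hu : N.Admissible u) (h : u ≤ v) : N.Admissible v := by
  refine ⟨fun i => (hu.1 i).trans_le (h i), fun i k hik => (hu.2 i k hik).trans ?_⟩
  exact mul_le_mul (withSlack_mono h i) (withSlack_mono h k) (withSlack_pos hu.1 k).le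
    ((withSlack_pos hu.1 i).le.trans (withSlack_mono h i))

variable (N)

/-- Admissibility is not needed: `√` is monotone on all of `ℝ`, being zero on negative numbers. -/
theorem sum_sqrt_mono {u v : Fin n → ℝ} (hu : ∀ i, 0 < u i) (h : u ≤ v) (i : Fin (n + 1)) :
    ∑ k ∈ N.nbr i, N.Br i k * √(withSlack u i * withSlack u k - N.flow i k ^ 2) ≤
    ∑ k ∈ N.nbr i, N.Br i k * √(withSlack v i * withSlack v k - N.flow i k ^ 2) := by
  refine Finset.sum_le_sum fun k hk => mul_le_mul_of_nonneg_left (Real.sqrt_le_sqrt ?_)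
    (N.Br_pos (N.mem_nbr.1 hk)).le
  exact sub_le_sub_right (mul_le_mul (withSlack_mono h i) (withSlack_mono h k)
    (withSlack_pos hu k).le ((withSlack_pos hu i).le.trans (withSlack_mono h i))) _

theorem g_mono {u v : Fin n → ℝ} (hu : ∀ i, 0 < u i) (h : u ≤ v) : N.g u ≤ N.g v := by
  intro i
  refine le_of_mul_le_mul_left ?_ (N.Btot_pos i)
  rw [Btot_mul_g, Btot_mul_g]
  exact add_le_add_right (N.sum_sqrt_mono hu h i.succ) _

theorem continuous_withSlack (j : Fin (n + 1)) :
    Continuous fun v : Fin n → ℝ => withSlack v j := by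
  refine Fin.cases ?_ (fun i => ?_) j
  · simpa using continuous_const
  · simpa using continuous_apply i

theorem continuous_g : Continuous N.g := by
  have := @continuous_withSlack n
  refine continuous_pi fun i => ?_
  unfold g
  fun_prop

/-! ### The starting point of the iteration -/

/-- The summand `1` of `vmax` agrees with the slack value, so it is a constant on all buses and the
Laplacian annihilates it. -/
theorem lap_vmax (i : Fin n) :
    ∑ k ∈ N.nbr i.succ, N.Br i.succ k * (withSlack N.vmax i.succ - withSlack N.vmax k) =
      2 * N.qr i := by
  have hV : ∀ j, withSlack N.vmax j = 1 + 2 * withSlackPhase (N.lapRed⁻¹.mulVec N.qr) j := by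
    intro j
    refine Fin.cases ?_ (fun i => ?_) j <;> simp [vmax]
  conv_rhs => rw [← congrFun (N.lapRed_mulVec_inv N.qr) i, lapRed_mulVec, Finset.mul_sum]
  refine Finset.sum_congr rfl fun k _ => ?_
  rw [hV, hV]
  ring

/-- Replacing each root by the arithmetic mean of `v i` and `v k` turns the balance into half the
Laplacian. -/
theorem balance_ge {v : Fin n → ℝ} (hv : ∀ i, 0 < v i) (i : Fin n) :
    ∑ k ∈ N.nbr i.succ, N.Br i.succ k * (withSlack v i.succ - withSlack v k) ≤
      2 * N.balance v i := by
  rw [balance, mul_sub, Btot, Finset.sum_mul, Finset.mul_sum, Finset.mul_sum,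
    ← Finset.sum_sub_distrib]
  refine Finset.sum_le_sum fun k hk => ?_
  have h1 := N.Br_pos (N.mem_nbr.1 hk)
  have h2 := sqrt_mul_sub_sq_le (withSlack_pos hv i.succ).le (withSlack_pos hv k).le
    (N.flow i.succ k)
  have h3 := mul_le_mul_of_nonneg_left h2 h1.le
  rw [withSlack_succ] at *
  linarith

/-- The difference `vmax - v` vanishes at the substation and has Laplacian at least `2 * qr - 2 *
balance v ≥ 0`, so the minimum principle applies. -/
theorem le_vmax {v : Fin n → ℝ} (hv : v ∈ N.relaxFeasible) : v ≤ N.vmax := by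
  have := N.nonneg_of_lap_nonneg (X := fun j => withSlack N.vmax j - withSlack v j) (by simp)
    (fun i => by
      have h1 := N.balance_ge hv.1.1 i
      have h2 := N.lap_vmax i
      have h3 := hv.2 i
      have h4 : ∑ k ∈ N.nbr i.succ, N.Br i.succ k * (withSlack N.vmax i.succ - withSlack v i.succ -
          (withSlack N.vmax k - withSlack v k)) =
          ∑ k ∈ N.nbr i.succ, N.Br i.succ k * (withSlack N.vmax i.succ - withSlack N.vmax k) -
          ∑ k ∈ N.nbr i.succ, N.Br i.succ k * (withSlack v i.succ - withSlack v k) := by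
        rw [← Finset.sum_sub_distrib]
        exact Finset.sum_congr rfl fun k _ => by ring
      rw [h4]
      linarith)
  intro i
  simpa using this i.succ

theorem g_vmax_le (hv : ∀ i, 0 < N.vmax i) : N.g N.vmax ≤ N.vmax := by
  intro i
  have h1 := N.balance_ge hv i
  rw [lap_vmax, balance_eq] at h1
  have := N.Btot_pos i
  by_contra! h
  nlinarith [mul_pos this (sub_pos.2 h)]

/-- If the relaxation is feasible then the iteration converges to the greatest feasible point. -/
theorem exists_isGreatest (hne : N.relaxFeasible.Nonempty) :
    ∃ v, (∀ m : ℕ, N.Admissible (N.g^[m] N.vmax)) ∧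
      Filter.Tendsto (fun m : ℕ => N.g^[m] N.vmax) Filter.atTop (nhds v) ∧
      IsGreatest N.relaxFeasible v ∧ v ∈ N.fixedPoints := by
  have hle : ∀ u ∈ N.relaxFeasible, ∀ m : ℕ, u ≤ N.g^[m] N.vmax := by
    intro u hu m
    induction m with
    | zero => exact N.le_vmax hu
    | succ m ih =>
      rw [Function.iterate_succ_apply']
      exact le_trans (fun i => (N.balance_le_iff u i).1 (hu.2 i)) (N.g_mono hu.1.1 ih)
  obtain ⟨u, hu⟩ := hne
  have hadm : ∀ m : ℕ, N.Admissible (N.g^[m] N.vmax) := fun m => hu.1.mono (hle u hu m)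
  have hanti : Antitone fun m : ℕ => N.g^[m] N.vmax := by
    refine antitone_nat_of_succ_le fun m => ?_
    induction m with
    | zero => exact N.g_vmax_le (hadm 0).1
    | succ m ih =>
      have hpos := (hadm (m + 1)).1
      simp only [Function.iterate_succ_apply'] at hpos ih ⊢
      exact N.g_mono hpos ih
  have hlim : Filter.Tendsto (fun m : ℕ => N.g^[m] N.vmax) Filter.atTop
      (nhds fun i => ⨅ m : ℕ, (N.g^[m] N.vmax) i) := by
    refine tendsto_pi_nhds.2 fun i => tendsto_atTop_ciInf (fun a b h => hanti h i) ⟨u i, ?_⟩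
    rintro _ ⟨m, rfl⟩
    exact hle u hu m i
  have hge : ∀ u ∈ N.relaxFeasible, u ≤ fun i => ⨅ m : ℕ, (N.g^[m] N.vmax) i := fun u hu =>
    ge_of_tendsto' hlim (hle u hu)
  -- With the total square root, `g` is continuous everywhere, also where a radicand vanishes.
  have hfix := isFixedPt_of_tendsto_iterate hlim N.continuous_g.continuousAt
  have hmem : (fun i => ⨅ m : ℕ, (N.g^[m] N.vmax) i) ∈ N.fixedPoints :=
    ⟨hu.1.mono (hge u hu), hfix⟩
  exact ⟨_, hadm, hlim, ⟨N.fixedPoints_subset hmem, hge⟩, hmem⟩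

/-! ### Solutions of the power flow equations -/

/-- A solution may have negative `c`, so its `v` need not be a fixed point of `g`. The bound `c ≤
√(v i * v k - s i k ^ 2)` still makes it feasible. -/
theorem relaxFeasible_of_solution {x : PowerFlowState n} (hx : N.IsPowerFlowSolution x) :
    x.v ∈ N.relaxFeasible := by
  obtain ⟨hv, -, -, -, hb, hq⟩ := hx
  refine ⟨⟨hv, fun i k h => ?_⟩, fun i => ?_⟩
  · rw [← hq i k h]
    nlinarith [sq_nonneg (x.c i k)]
  · rw [← hb i, balance]
    refine sub_le_sub_left (Finset.sum_le_sum fun k hk => mul_le_mul_of_nonneg_left ?_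
      (N.Br_pos (N.mem_nbr.1 hk)).le) _
    rw [← hq _ k (N.mem_nbr.1 hk)]
    exact Real.le_sqrt_of_sq_le (by linarith)

theorem solution_stateOf {v : Fin n → ℝ} (hv : v ∈ N.fixedPoints) :
    N.IsPowerFlowSolution (N.stateOf v) := by
  obtain ⟨hadm, hb⟩ := N.fixedPoints_iff.1 hv
  refine ⟨hadm.1, rfl, fun i k => ?_, fun i k h => if_neg h, fun i => ?_, fun i k h => ?_⟩
  · by_cases h : N.graph.Adj i k
    · simp [stateOf, onLines, h, h.symm, N.flow_sq_symm k i, mul_comm (withSlack v k)]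
    · simp [stateOf, onLines, h, mt SimpleGraph.Adj.symm h]
  · rw [← hb i, balance]
    congr 1
    exact Finset.sum_congr rfl fun k hk => by simp only [stateOf, onLines, if_pos (N.mem_nbr.1 hk)]
  · simp only [stateOf, onLines, if_pos h]
    rw [Real.sq_sqrt (sub_nonneg.2 (hadm.2 i k h))]
    ring

/-- The objective is strictly increasing in every coordinate, so on a set with a greatest element
the weights play no role. -/
theorem isRelaxOptimal_iff {w v u : Fin n → ℝ} (hw : ∀ i, 0 < w i)
    (hv : IsGreatest N.relaxFeasible v) : N.IsRelaxOptimal w u ↔ u = v := by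
  have hterm : ∀ u ∈ N.relaxFeasible, ∀ i, w i * Real.log (u i) ≤ w i * Real.log (v i) :=
    fun u hu i => mul_le_mul_of_nonneg_left (Real.log_le_log (hu.1.1 i) (hv.2 hu i)) (hw i).le
  constructor
  · rintro ⟨hu, hmax⟩
    have hmax' := hmax hv.1
    simp only [Set.mem_ofPred_eq] at hmax'
    have heq := (Finset.sum_eq_sum_iff_of_le fun i _ => hterm u hu i).1
      (le_antisymm (Finset.sum_le_sum fun i _ => hterm u hu i) hmax')
    funext i
    exact Real.log_injOn_pos (hu.1.1 i) (hv.1.1.1 i)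
      (mul_left_cancel₀ (hw i).ne' (heq i (Finset.mem_univ i)))
  · rintro rfl
    exact ⟨hv.1, fun y hy => Finset.sum_le_sum fun i _ => hterm y hy i⟩

open Matrix Filter Topology

/-! ### The convexity matrix -/

/-- The weight of a line in the convexity matrix. -/
noncomputable def lineWeight (v θ : Fin n → ℝ) (i k : Fin (n + 1)) : ℝ :=
  N.Br i k * √(withSlack v i * withSlack v k) / Real.cos (withSlackPhase θ i - withSlackPhase θ k)

theorem lineWeight_symm (v θ : Fin n → ℝ) {i k : Fin (n + 1)} (h : N.graph.Adj i k) :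
    N.lineWeight v θ i k = N.lineWeight v θ k i := by
  unfold lineWeight
  rw [N.Br_symm h, mul_comm (withSlack v i), ← Real.cos_neg, neg_sub]

theorem unitVec_dotProduct (j : Fin (n + 1)) (x : Fin n → ℝ) :
    unitVec j ⬝ᵥ x = withSlackPhase x j := by
  refine Fin.cases ?_ (fun i => ?_) j
  · simp [unitVec, dotProduct, (Fin.succ_ne_zero _).symm]
  · simp [unitVec, dotProduct]

theorem convexityMatrix_mulVec (v θ x : Fin n → ℝ) (i : Fin n) :
    (N.convexityMatrix v θ *ᵥ x) i = N.Btot i.succ * (2 * v i) * x i -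
      ∑ k ∈ N.nbr i.succ, N.lineWeight v θ i.succ k * (x i + withSlackPhase x k) := by
  classical
  rw [convexityMatrix, sub_mulVec, Pi.sub_apply, mulVec_diagonal, sum_mulVec, Finset.sum_apply]
  congr 1
  -- The indicator of row `i` converts the sum over oriented lines into a sum over the neighbours of
  -- `i`.
  have h := N.sum_lines (fun a b => if a = i.succ then
    N.lineWeight v θ a b * (withSlackPhase x a + withSlackPhase x b) else 0)
  rw [Finset.sum_eq_single i.succ (fun a _ ha => Finset.sum_eq_zero fun k _ => if_neg ha)
    (fun h => absurd (Finset.mem_univ _) h)] at h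
  simp only [if_true, withSlackPhase_succ] at h
  rw [← h]
  refine Finset.sum_congr rfl fun e he => ?_
  have hs := N.lineWeight_symm v θ (N.mem_lines.1 he).1
  rw [smul_mulVec, vecMulVec_mulVec, add_dotProduct, unitVec_dotProduct, unitVec_dotProduct,
    ← hs]
  change N.lineWeight v θ e.1 e.2 * ((unitVec e.1 i + unitVec e.2 i) *
    (withSlackPhase x e.1 + withSlackPhase x e.2)) = _
  unfold unitVec
  split_ifs <;> ring

theorem dotProduct_convexityMatrix (v θ x : Fin n → ℝ) :
    x ⬝ᵥ (N.convexityMatrix v θ *ᵥ x) = ∑ i, N.Btot i.succ * (2 * v i) * x i ^ 2 -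
      ∑ e ∈ N.lines, N.lineWeight v θ e.1 e.2 *
        (withSlackPhase x e.1 + withSlackPhase x e.2) ^ 2 := by
  have h := N.sum_lines_of_slack (f := fun a b => withSlackPhase x a *
    (N.lineWeight v θ a b * (withSlackPhase x a + withSlackPhase x b))) (fun k => by simp)
  have h' : ∑ e ∈ N.lines, N.lineWeight v θ e.1 e.2 *
        (withSlackPhase x e.1 + withSlackPhase x e.2) ^ 2 = _ := (Finset.sum_congr rfl fun e he => by
      rw [← N.lineWeight_symm v θ (N.mem_lines.1 he).1]; ring).trans h
  rw [h', dotProduct, ← Finset.sum_sub_distrib]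
  refine Finset.sum_congr rfl fun i _ => ?_
  rw [convexityMatrix_mulVec, mul_sub, Finset.mul_sum]
  congr 1
  ring

theorem convexityMatrix_isHermitian (v θ : Fin n → ℝ) : (N.convexityMatrix v θ).IsHermitian := by
  refine Matrix.IsHermitian.ext fun i j => ?_
  simp only [convexityMatrix, Matrix.sub_apply, Matrix.sum_apply, Matrix.smul_apply,
    Matrix.vecMulVec_apply, star_trivial, Matrix.diagonal_apply]
  congr 1
  · by_cases h : i = j
    · subst h; rfl
    · simp [h, Ne.symm h]
  · exact Finset.sum_congr rfl fun e _ => by rw [mul_comm ((unitVec e.1 + unitVec e.2) j)]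

theorem posSemidef_convexityMatrix_iff (v θ : Fin n → ℝ) :
    (N.convexityMatrix v θ).PosSemidef ↔
      ∀ x, 0 ≤ x ⬝ᵥ (N.convexityMatrix v θ *ᵥ x) := by
  rw [posSemidef_iff_dotProduct_mulVec, and_iff_right (N.convexityMatrix_isHermitian v θ)]
  simp only [star_trivial]

theorem withSlackPhase_abs (x : Fin n → ℝ) (j : Fin (n + 1)) :
    withSlackPhase |x| j = |withSlackPhase x j| := by
  refine Fin.cases ?_ (fun i => ?_) j <;> simp

/-- The diagonal part sees only `x i ^ 2`, while each line subtracts a multiple of `(x i + x k) ^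
2`, which grows under absolute values. -/
theorem dotProduct_convexityMatrix_abs_le (v θ x : Fin n → ℝ)
    (hw : ∀ e ∈ N.lines, 0 ≤ N.lineWeight v θ e.1 e.2) :
    |x| ⬝ᵥ (N.convexityMatrix v θ *ᵥ |x|) ≤ x ⬝ᵥ (N.convexityMatrix v θ *ᵥ x) := by
  rw [dotProduct_convexityMatrix, dotProduct_convexityMatrix]
  refine sub_le_sub (le_of_eq (by simp)) (Finset.sum_le_sum fun e he =>
    mul_le_mul_of_nonneg_left ?_ (hw e he))
  rw [withSlackPhase_abs, withSlackPhase_abs, ← sq_abs (_ + _)]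
  exact pow_le_pow_left₀ (abs_nonneg _) (abs_add_le _ _) 2

/-- A symmetric matrix whose quadratic form does not increase under `x ↦ |x|` is positive
semidefinite or has a nonnegative eigenvector with a negative eigenvalue. -/
theorem _root_.Matrix.IsHermitian.exists_nonneg_eigenvector {A : Matrix (Fin n) (Fin n) ℝ}
    (hA : A.IsHermitian) (habs : ∀ x, |x| ⬝ᵥ (A *ᵥ |x|) ≤ x ⬝ᵥ (A *ᵥ x))
    (hn : ¬ A.PosSemidef) :
    ∃ μ < (0 : ℝ), ∃ x, 0 ≤ x ∧ x ≠ 0 ∧ A *ᵥ x = μ • x := by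
  have hn' : ∃ y, y ⬝ᵥ (A *ᵥ y) < 0 := by
    by_contra! h
    exact hn (posSemidef_iff_dotProduct_mulVec.2 ⟨hA, by simpa using h⟩)
  obtain ⟨y, hy⟩ := hn'
  have hsq : ∀ x : Fin n → ℝ, 0 ≤ x ⬝ᵥ x := fun x =>
    Finset.sum_nonneg fun i _ => mul_self_nonneg (x i)
  have hpos : ∀ x : Fin n → ℝ, x ≠ 0 → 0 < x ⬝ᵥ x := fun x hx =>
    lt_of_le_of_ne (hsq x) (fun h => hx (dotProduct_self_eq_zero.1 h.symm))
  have hy0 : y ≠ 0 := by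
    rintro rfl
    simp at hy
  let S : Set (Fin n → ℝ) := {x | x ⬝ᵥ x = 1}
  have hScont : Continuous fun x : Fin n → ℝ => x ⬝ᵥ x := by
    unfold dotProduct
    fun_prop
  have hS : IsCompact S := by
    refine Metric.isCompact_of_isClosed_isBounded (isClosed_eq hScont continuous_const)
      (isBounded_iff_forall_norm_le.2 ⟨1, fun x hx => ?_⟩)
    refine (pi_norm_le_iff_of_nonneg zero_le_one).2 fun i => ?_
    have h1 : x i * x i ≤ x ⬝ᵥ x :=
      Finset.single_le_sum (f := fun i => x i * x i) (fun i _ => mul_self_nonneg (x i))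
        (Finset.mem_univ i)
    rw [show x ⬝ᵥ x = 1 from hx] at h1
    rw [Real.norm_eq_abs]
    exact abs_le_one_iff_mul_self_le_one.2 h1
  have hscale : ∀ x : Fin n → ℝ, x ≠ 0 → (√(x ⬝ᵥ x))⁻¹ • x ∈ S := fun x hx => by
    have h1 := hpos x hx
    change _ ⬝ᵥ _ = _
    rw [smul_dotProduct, dotProduct_smul, smul_eq_mul, smul_eq_mul, ← mul_assoc, ← mul_inv,
      Real.mul_self_sqrt h1.le, inv_mul_cancel₀ h1.ne']
  -- The minimum `μ` of the Rayleigh quotient is the lowest eigenvalue.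
  obtain ⟨z, hz, hmin⟩ := hS.exists_isMinOn ⟨_, hscale y hy0⟩
    (f := fun x => x ⬝ᵥ (A *ᵥ x)) (by unfold dotProduct mulVec dotProduct; fun_prop)
  have hz1 : z ⬝ᵥ z = 1 := hz
  set μ := z ⬝ᵥ (A *ᵥ z) with hμ
  have hge : ∀ x, μ * (x ⬝ᵥ x) ≤ x ⬝ᵥ (A *ᵥ x) := by
    intro x
    by_cases hx : x = 0
    · subst hx; simp
    · have h1 := hpos x hx
      have h2 : μ ≤ ((√(x ⬝ᵥ x))⁻¹ • x) ⬝ᵥ (A *ᵥ ((√(x ⬝ᵥ x))⁻¹ • x)) := hmin (hscale x hx)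
      rw [mulVec_smul, smul_dotProduct, dotProduct_smul, smul_eq_mul, smul_eq_mul, ← mul_assoc,
        ← mul_inv, Real.mul_self_sqrt h1.le] at h2
      rwa [inv_mul_eq_div, le_div_iff₀ h1] at h2
  have hμneg : μ < 0 := by
    by_contra! h
    have := hge y
    nlinarith [mul_nonneg h (hsq y)]
  have habs_sq : |z| ⬝ᵥ |z| = 1 := by
    rw [← hz1]
    simp [dotProduct]
  have hquad : ∀ x, x ⬝ᵥ ((A - μ • 1) *ᵥ x) = x ⬝ᵥ (A *ᵥ x) - μ * (x ⬝ᵥ x) := by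
    intro x
    rw [sub_mulVec, dotProduct_sub, smul_mulVec, one_mulVec, dotProduct_smul, smul_eq_mul]
  have hpsd : (A - μ • (1 : Matrix (Fin n) (Fin n) ℝ)).PosSemidef := by
    refine posSemidef_iff_dotProduct_mulVec.2 ⟨?_, fun x => ?_⟩
    · refine hA.sub ?_
      simp [IsHermitian]
    · rw [star_trivial, hquad]
      exact sub_nonneg.2 (hge x)
  -- By `habs` the unit vector `|z|` is a minimizer as well. The semidefinite form of `A - μ • 1`
  -- vanishes at it, so it lies in the kernel.
  have hker := (hpsd.dotProduct_mulVec_zero_iff |z|).1 (by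
    rw [star_trivial]
    refine le_antisymm ?_ (by simpa using (posSemidef_iff_dotProduct_mulVec.1 hpsd).2 |z|)
    rw [hquad, habs_sq]
    linarith [habs z])
  refine ⟨μ, hμneg, |z|, abs_nonneg z, ?_, ?_⟩
  · intro h
    rw [h] at habs_sq
    simp at habs_sq
  · rw [sub_mulVec, smul_mulVec, one_mulVec] at hker
    exact sub_eq_zero.1 hker

/-! ### The greatest feasible point -/

/-- A small step along `d ≥ 0` keeps admissibility, so the balance at each bus is all that has to be
checked. Nothing feasible exceeds the greatest point. -/
theorem eq_zero_of_feasible_direction {v d : Fin n → ℝ} (hv : IsGreatest N.relaxFeasible v)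
    (hd : 0 ≤ d) (h : ∀ i, ∀ᶠ t in 𝓝[>] (0 : ℝ), N.balance (v + t • d) i ≤ N.qr i) : d = 0 := by
  obtain ⟨t, ht, htpos⟩ := ((eventually_all.2 h).and self_mem_nhdsWithin).exists
  have htpos' : 0 < t := htpos
  have hadm : N.Admissible (v + t • d) := hv.1.1.mono (le_add_of_nonneg_right
    (smul_nonneg htpos'.le hd))
  refine le_antisymm (fun i => ?_) hd
  have := hv.2 ⟨hadm, ht⟩ i
  simp only [Pi.add_apply, Pi.smul_apply, smul_eq_mul] at this
  simp only [Pi.zero_apply]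
  by_contra! h'
  nlinarith [mul_pos htpos' h']

theorem balance_le_of_eq {u v : Fin n → ℝ} (hu : ∀ i, 0 < u i) (h : u ≤ v) {i : Fin n}
    (hi : v i = u i) : N.balance v i ≤ N.balance u i := by
  rw [balance, balance, hi]
  exact sub_le_sub_left (N.sum_sqrt_mono hu h i.succ) _

/-- Raising `v i` by `t` costs `Btot * t`, but the root on the tight line grows from zero to at
least `√(t * v k)`, which wins for small `t`. -/
theorem balance_le_of_tight {v : Fin n → ℝ} (hv : ∀ i, 0 < v i) {i : Fin n} {k : Fin (n + 1)}
    (hik : N.graph.Adj i.succ k)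
    (h0 : withSlack v i.succ * withSlack v k - N.flow i.succ k ^ 2 = 0)
    {u : Fin n → ℝ} (huv : v ≤ u) {t : ℝ} (ht : 0 ≤ t) (hui : u i = v i + t)
    (hsmall : N.Btot i.succ * t ≤ N.Br i.succ k * √(t * withSlack v k)) :
    N.balance u i ≤ N.balance v i := by
  classical
  have hterm : ∀ m ∈ N.nbr i.succ,
      N.Br i.succ m * √(withSlack v i.succ * withSlack v m - N.flow i.succ m ^ 2) +
        (if m = k then N.Br i.succ k * √(t * withSlack v k) else 0) ≤
      N.Br i.succ m * √(withSlack u i.succ * withSlack u m - N.flow i.succ m ^ 2) := by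
    intro m hm
    have hB := (N.Br_pos (N.mem_nbr.1 hm)).le
    have h1 := withSlack_mono huv m
    have h2 := withSlack_mono huv i.succ
    have h3 := withSlack_pos hv m
    have h4 := withSlack_pos hv i.succ
    split_ifs with hmk
    · subst hmk
      rw [h0, Real.sqrt_zero, mul_zero, zero_add]
      refine mul_le_mul_of_nonneg_left (Real.sqrt_le_sqrt ?_) hB
      simp only [withSlack_succ, hui] at *
      nlinarith
    · rw [add_zero]
      refine mul_le_mul_of_nonneg_left (Real.sqrt_le_sqrt ?_) hB
      nlinarith
  have hsum := Finset.sum_le_sum hterm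
  rw [Finset.sum_add_distrib, Finset.sum_ite_eq', if_pos (N.mem_nbr.2 hik)] at hsum
  rw [balance, balance, hui]
  linarith

theorem eventually_mul_le_mul_sqrt {a b c : ℝ} (hb : 0 < b) (hc : 0 < c) :
    ∀ᶠ t in 𝓝[>] (0 : ℝ), a * t ≤ b * √(t * c) := by
  have h : Tendsto (fun t => a * √t) (𝓝[>] (0 : ℝ)) (𝓝 0) := by
    have : Continuous fun t => a * √t := by fun_prop
    simpa using (this.tendsto 0).mono_left nhdsWithin_le_nhds
  filter_upwards [h.eventually (gt_mem_nhds (mul_pos hb (Real.sqrt_pos.2 hc))),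
    self_mem_nhdsWithin] with t ht htpos
  rw [Real.sqrt_mul (le_of_lt htpos)]
  calc a * t = √t * (a * √t) := by
        rw [mul_left_comm, Real.mul_self_sqrt (le_of_lt htpos)]
    _ ≤ √t * (b * √c) := mul_le_mul_of_nonneg_left ht.le (Real.sqrt_nonneg t)
    _ = _ := by ring

/-- At the greatest feasible point the line variables `c` do not vanish. -/
theorem line_slack_pos {v : Fin n → ℝ} (hv : IsGreatest N.relaxFeasible v) {a b : Fin (n + 1)}
    (hab : N.graph.Adj a b) : 0 < withSlack v a * withSlack v b - N.flow a b ^ 2 := by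
  by_contra! hle
  have h0 : withSlack v a * withSlack v b - N.flow a b ^ 2 = 0 :=
    le_antisymm hle (sub_nonneg.2 (hv.1.1.2 a b hab))
  have hpos := hv.1.1.1
  -- Raise both ends of the tight line; a substation end contributes zero. Each raised bus gains of
  -- order `√t` on this line, and the other buses only profit from higher neighbours.
  set d : Fin n → ℝ := unitVec a + unitVec b with hd
  have hd0 : 0 ≤ d := by
    intro i
    simp only [hd, Pi.add_apply, Pi.zero_apply, unitVec]
    split_ifs <;> norm_num
  have hzero : d = 0 := by
    refine N.eq_zero_of_feasible_direction hv hd0 fun i => ?_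
    have hmono : ∀ t : ℝ, 0 < t → v ≤ v + t • d := fun t ht =>
      le_add_of_nonneg_right (smul_nonneg ht.le hd0)
    by_cases hia : a = i.succ
    · subst hia
      filter_upwards [eventually_mul_le_mul_sqrt (a := N.Btot i.succ) (N.Br_pos hab)
        (withSlack_pos hpos b), self_mem_nhdsWithin] with t ht htpos
      refine (N.balance_le_of_tight hpos hab h0 (hmono t htpos) (le_of_lt htpos) ?_ ht).trans
        (hv.1.2 i)
      simp [hd, unitVec, hab.ne']
    · by_cases hib : b = i.succ
      · subst hib
        filter_upwards [eventually_mul_le_mul_sqrt (a := N.Btot i.succ) (N.Br_pos hab.symm)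
          (withSlack_pos hpos a), self_mem_nhdsWithin] with t ht htpos
        refine (N.balance_le_of_tight hpos hab.symm ?_ (hmono t htpos) (le_of_lt htpos) ?_
          ht).trans (hv.1.2 i)
        · rw [mul_comm, N.flow_sq_symm, h0]
        · simp [hd, unitVec, hab.ne]
      · filter_upwards [self_mem_nhdsWithin] with t htpos
        refine (N.balance_le_of_eq hpos (hmono t htpos) ?_).trans (hv.1.2 i)
        simp [hd, unitVec, hia, hib]
  rcases Fin.eq_zero_or_eq_succ a with ha | ⟨i, ha⟩
  · rcases Fin.eq_zero_or_eq_succ b with hb | ⟨i, hb⟩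
    · exact hab.ne (ha.trans hb.symm)
    · have := congrFun hzero i
      simp [hd, unitVec, ha, hb, (Fin.succ_ne_zero _).symm] at this
  · have := congrFun hzero i
    simp only [hd, unitVec, ha, Pi.add_apply, Pi.zero_apply, if_true] at this
    split_ifs at this <;> norm_num at this

/-! ### The convexity matrix as Jacobian of the balance, and the tangent bound -/

theorem lineWeight_pos {v θ : Fin n → ℝ} (hv : ∀ i, 0 < v i) {i k : Fin (n + 1)}
    (h : N.graph.Adj i k) (hcos : 0 < Real.cos (withSlackPhase θ i - withSlackPhase θ k)) :
    0 < N.lineWeight v θ i k :=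
  div_pos (mul_pos (N.Br_pos h) (Real.sqrt_pos.2 (mul_pos (withSlack_pos hv i)
    (withSlack_pos hv k)))) hcos

/-- `v i * v k / c i k` for `c i k = √(v i * v k) * cos (θ i - θ k)`. -/
theorem lineWeight_eq {v θ : Fin n → ℝ} (hv : ∀ i, 0 < v i) {i k : Fin (n + 1)}
    (hcos : 0 < Real.cos (withSlackPhase θ i - withSlackPhase θ k)) {c : ℝ}
    (hc : √(withSlack v i * withSlack v k) *
      Real.cos (withSlackPhase θ i - withSlackPhase θ k) = c) :
    N.lineWeight v θ i k = N.Br i k * (withSlack v i * withSlack v k) / c := by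
  have h1 := mul_pos (withSlack_pos hv i) (withSlack_pos hv k)
  have h2 := Real.sqrt_pos.2 h1
  have h3 := Real.mul_self_sqrt h1.le
  rw [← hc, lineWeight, div_eq_div_iff hcos.ne' (mul_pos h2 hcos).ne']
  linear_combination (N.Br i k * Real.cos (withSlackPhase θ i - withSlackPhase θ k)) * h3

theorem eventually_lt_of_hasDerivAt_neg {f : ℝ → ℝ} {f' : ℝ} (hf : HasDerivAt f f' 0)
    (h : f' < 0) : ∀ᶠ t in 𝓝[>] (0 : ℝ), f t < f 0 := by
  have h1 := (hasDerivAt_iff_tendsto_slope.1 hf).mono_left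
    (nhdsWithin_mono (0 : ℝ) fun t (ht : 0 < t) => ht.ne')
  filter_upwards [h1.eventually (gt_mem_nhds h), self_mem_nhdsWithin] with t ht htpos
  have htpos' : 0 < t := htpos
  rw [slope_def_field, sub_zero, div_neg_iff] at ht
  rcases ht with ht | ht
  · linarith
  · linarith

theorem hasDerivAt_sqrt_line {a b α β s : ℝ} (h : 0 < a * b - s ^ 2) :
    HasDerivAt (fun t : ℝ => √((a + t * α) * (b + t * β) - s ^ 2))
      ((α * b + a * β) / (2 * √(a * b - s ^ 2))) 0 := by
  have h1 : HasDerivAt (fun t : ℝ => a + t * α) α 0 := by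
    simpa using ((hasDerivAt_id (0 : ℝ)).mul_const α).const_add a
  have h2 : HasDerivAt (fun t : ℝ => b + t * β) β 0 := by
    simpa using ((hasDerivAt_id (0 : ℝ)).mul_const β).const_add b
  have h3 := ((h1.mul h2).sub_const (s ^ 2)).sqrt (by simpa using h.ne')
  simpa using h3

/-- The direction `v * x` is, to first order, the direction `x` in `log v`; extending `x` by zero
keeps the slack value at `1`. -/
theorem withSlack_add_smul (v x : Fin n → ℝ) (t : ℝ) (j : Fin (n + 1)) :
    withSlack (v + t • (v * x)) j =
      withSlack v j + t * (withSlack v j * withSlackPhase x j) := by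
  refine Fin.cases ?_ (fun i => ?_) j <;> simp

/-- The phases `θ` and squared magnitudes `v` produce the line flows, with `c > 0`. -/
structure IsCompatible (v θ : Fin n → ℝ) : Prop where
  pos : ∀ i, 0 < v i
  cos_pos : ∀ i k, N.graph.Adj i k → 0 < Real.cos (withSlackPhase θ i - withSlackPhase θ k)
  slack_pos : ∀ i k, N.graph.Adj i k → 0 < withSlack v i * withSlack v k - N.flow i k ^ 2
  mul_cos : ∀ i k, N.graph.Adj i k → √(withSlack v i * withSlack v k) *
    Real.cos (withSlackPhase θ i - withSlackPhase θ k) =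
      √(withSlack v i * withSlack v k - N.flow i k ^ 2)

variable {N}

theorem IsCompatible.lineWeight_eq {v θ : Fin n → ℝ} (h : N.IsCompatible v θ)
    {i k : Fin (n + 1)} (hik : N.graph.Adj i k) :
    N.lineWeight v θ i k = N.Br i k * (withSlack v i * withSlack v k) /
      √(withSlack v i * withSlack v k - N.flow i k ^ 2) :=
  N.lineWeight_eq h.pos (h.cos_pos i k hik) (h.mul_cos i k hik)

/-- The convexity matrix is, up to a factor, the Jacobian of the balance in logarithmic
variables. -/
theorem IsCompatible.hasDerivAt_balance {v θ : Fin n → ℝ} (h : N.IsCompatible v θ)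
    (x : Fin n → ℝ) (i : Fin n) :
    HasDerivAt (fun t : ℝ => N.balance (v + t • (v * x)) i)
      ((N.convexityMatrix v θ *ᵥ x) i / 2) 0 := by
  have h1 : HasDerivAt (fun t : ℝ => N.Btot i.succ * (v i + t * (v i * x i)))
      (N.Btot i.succ * (v i * x i)) 0 := by
    simpa using (((hasDerivAt_id (0 : ℝ)).mul_const (v i * x i)).const_add (v i)).const_mul
      (N.Btot i.succ)
  have h2 := h1.fun_sub (HasDerivAt.fun_sum (u := N.nbr i.succ) fun k hk =>
    (hasDerivAt_sqrt_line (α := withSlack v i.succ * withSlackPhase x i.succ)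
      (β := withSlack v k * withSlackPhase x k)
      (h.slack_pos i.succ k (N.mem_nbr.1 hk))).const_mul (N.Br i.succ k))
  refine (h2.congr_deriv ?_).congr_of_eventuallyEq (Eventually.of_forall fun t => ?_)
  swap
  · simp only [balance, withSlack_add_smul, withSlack_succ, withSlackPhase_succ, Pi.add_apply,
      Pi.smul_apply, Pi.mul_apply, smul_eq_mul]
  · symm
    rw [convexityMatrix_mulVec, sub_div, Finset.sum_div]
    congr 1
    · ring
    · refine Finset.sum_congr rfl fun k hk => ?_
      have hik := N.mem_nbr.1 hk
      have hpos := Real.sqrt_pos.2 (h.slack_pos i.succ k hik)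
      rw [h.lineWeight_eq hik]
      simp only [withSlack_succ, withSlackPhase_succ]
      ring

/-- The convexity condition holds at the greatest feasible point. -/
theorem IsCompatible.posSemidef {v θ : Fin n → ℝ} (h : N.IsCompatible v θ)
    (hv : IsGreatest N.relaxFeasible v) : (N.convexityMatrix v θ).PosSemidef := by
  by_contra hn
  have hw : ∀ i k, N.graph.Adj i k → 0 < N.lineWeight v θ i k := fun i k hik =>
    N.lineWeight_pos h.pos hik (h.cos_pos i k hik)
  obtain ⟨μ, hμ, x, hx0, hxne, hx⟩ :=
    (N.convexityMatrix_isHermitian v θ).exists_nonneg_eigenvector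
      (fun x => N.dotProduct_convexityMatrix_abs_le v θ x
        fun e he => (hw _ _ (N.mem_lines.1 he).1).le) hn
  have hX0 : ∀ j, 0 ≤ withSlackPhase x j := by
    intro j
    refine Fin.cases le_rfl (fun i => ?_) j
    simpa using hx0 i
  have hd0 : 0 ≤ v * x := fun i => mul_nonneg (h.pos i).le (hx0 i)
  have hd := N.eq_zero_of_feasible_direction hv hd0 fun i => by
    rcases (hx0 i).eq_or_lt with hi | hi
    -- Here the derivative is zero and says nothing. But row `i` of the eigenvector equation forces
    -- `x` to vanish at all neighbours, so the balance at `i` is constant along the ray.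
    · have hxi : x i = 0 := hi.symm
      have h1 := congrFun hx i
      rw [convexityMatrix_mulVec, Pi.smul_apply, hxi, smul_zero, mul_zero, zero_sub,
        neg_eq_zero] at h1
      have h2 := (Finset.sum_eq_zero_iff_of_nonneg fun k hk => mul_nonneg
        (hw _ _ (N.mem_nbr.1 hk)).le (by simpa using hX0 k)).1 h1
      refine Eventually.of_forall fun t => le_trans (le_of_eq ?_) (hv.1.2 i)
      rw [balance, balance]
      congr 1
      · simp [hxi]
      · refine Finset.sum_congr rfl fun k hk => ?_
        have h3 : withSlackPhase x k = 0 := by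
          simpa [(hw _ _ (N.mem_nbr.1 hk)).ne'] using h2 k hk
        rw [withSlack_add_smul, withSlack_add_smul, h3, withSlackPhase_succ, hxi]
        simp
    -- Where `x i > 0` the derivative of the balance is `μ * x i / 2 < 0`.
    · have h1 := h.hasDerivAt_balance x i
      rw [hx] at h1
      have h2 := eventually_lt_of_hasDerivAt_neg h1
        (div_neg_of_neg_of_pos (mul_neg_of_neg_of_pos hμ hi) two_pos)
      filter_upwards [h2] with t ht
      rw [zero_smul, add_zero] at ht
      exact ht.le.trans (hv.1.2 i)
  refine hxne (funext fun i => ?_)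
  have := congrFun hd i
  simpa [(h.pos i).ne'] using this

/-- The tangent bound for `√(x * y - s ^ 2)`. -/
theorem sqrt_le_tangent {a b α β s : ℝ} (ha : 0 < a) (hb : 0 < b) (hα : 0 ≤ α) (hβ : 0 ≤ β)
    (h : 0 < a * b - s ^ 2) :
    √((a + a * α) * (b + b * β) - s ^ 2) ≤
      √(a * b - s ^ 2) + a * b * (α + β) / (2 * √(a * b - s ^ 2)) ∧
    (√((a + a * α) * (b + b * β) - s ^ 2) =
      √(a * b - s ^ 2) + a * b * (α + β) / (2 * √(a * b - s ^ 2)) → α = β) := by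
  set c := √(a * b - s ^ 2) with hc
  have hcpos : 0 < c := Real.sqrt_pos.2 h
  have hc2 : c ^ 2 = a * b - s ^ 2 := Real.sq_sqrt h.le
  have hab := mul_pos ha hb
  -- The square of the tangent exceeds the radicand by an explicit quantity, nonnegative because `α,
  -- β ≥ 0`; it vanishes only if `α = β`.
  have hkey : (c + a * b * (α + β) / (2 * c)) ^ 2 - ((a + a * α) * (b + b * β) - s ^ 2) =
      a * b / (4 * c ^ 2) * (a * b * (α - β) ^ 2 + 4 * s ^ 2 * (α * β)) := by
    have hs : s ^ 2 = a * b - c ^ 2 := by linarith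
    rw [hs]
    field_simp
    ring
  have hR : 0 ≤ c + a * b * (α + β) / (2 * c) := by positivity
  constructor
  · refine Real.sqrt_le_iff.2 ⟨hR, ?_⟩
    rw [← sub_nonneg, hkey]
    positivity
  · intro heq
    have h0 : 0 ≤ (a + a * α) * (b + b * β) - s ^ 2 := by
      have : 0 ≤ a * b * (α + β + α * β) := by positivity
      nlinarith
    rw [← heq, Real.sq_sqrt h0, sub_self] at hkey
    have h1 : a * b * (α - β) ^ 2 + 4 * s ^ 2 * (α * β) = 0 := by
      rcases mul_eq_zero.1 hkey.symm with h | h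
      · exact absurd h (by positivity)
      · exact h
    have h2 : 0 ≤ 4 * s ^ 2 * (α * β) := by positivity
    have h3 : (α - β) ^ 2 = 0 := by
      by_contra hne
      have : 0 < (α - β) ^ 2 := lt_of_le_of_ne (sq_nonneg _) (Ne.symm hne)
      nlinarith [mul_pos hab this]
    exact sub_eq_zero.1 (pow_eq_zero_iff two_ne_zero |>.1 h3)

/-- A fixed point at which the convexity condition holds is the greatest feasible point. -/
theorem IsCompatible.eq_of_posSemidef {u θ v : Fin n → ℝ} (h : N.IsCompatible u θ)
    (hu : ∀ i, N.balance u i = N.qr i) (hpsd : (N.convexityMatrix u θ).PosSemidef)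
    (huv : u ≤ v) (hv : ∀ i, N.balance v i = N.qr i) : u = v := by
  set x : Fin n → ℝ := fun i => (v i - u i) / u i with hx
  have hx0 : 0 ≤ x := fun i => div_nonneg (sub_nonneg.2 (huv i)) (h.pos i).le
  have hX0 : ∀ j, 0 ≤ withSlackPhase x j := by
    intro j
    refine Fin.cases le_rfl (fun i => ?_) j
    simpa using hx0 i
  have hV : ∀ j, withSlack v j = withSlack u j + withSlack u j * withSlackPhase x j := by
    intro j
    refine Fin.cases (by simp) (fun i => ?_) j
    have := (h.pos i).ne'
    simp only [withSlack_succ, withSlackPhase_succ, hx]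
    field_simp
    ring
  have htan : ∀ {i k}, N.graph.Adj i k → _ := fun {i k} hik =>
    sqrt_le_tangent (withSlack_pos h.pos i) (withSlack_pos h.pos k) (hX0 i) (hX0 k)
      (h.slack_pos i k hik)
  -- The balances at `u` and `v` agree, so the linearization at `u` along the relative increase `x`
  -- equals minus the weighted tangent gaps.
  have hgap : ∀ i, (N.convexityMatrix u θ *ᵥ x) i / 2 =
      -∑ k ∈ N.nbr i.succ, N.Br i.succ k *
        (√(withSlack u i.succ * withSlack u k - N.flow i.succ k ^ 2) +
          withSlack u i.succ * withSlack u k * (withSlackPhase x i.succ + withSlackPhase x k) /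
            (2 * √(withSlack u i.succ * withSlack u k - N.flow i.succ k ^ 2)) -
          √(withSlack v i.succ * withSlack v k - N.flow i.succ k ^ 2)) := by
    intro i
    have h1 := (hv i).trans (hu i).symm
    rw [balance, balance] at h1
    have h2 := hV i.succ
    rw [withSlack_succ, withSlack_succ, withSlackPhase_succ] at h2
    have h3 : ∑ k ∈ N.nbr i.succ, N.lineWeight u θ i.succ k * (x i + withSlackPhase x k) =
        ∑ k ∈ N.nbr i.succ, 2 * (N.Br i.succ k * (withSlack u i.succ * withSlack u k *
          (withSlackPhase x i.succ + withSlackPhase x k) /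
            (2 * √(withSlack u i.succ * withSlack u k - N.flow i.succ k ^ 2)))) := by
      refine Finset.sum_congr rfl fun k hk => ?_
      have hpos := Real.sqrt_pos.2 (h.slack_pos i.succ k (N.mem_nbr.1 hk))
      rw [h.lineWeight_eq (N.mem_nbr.1 hk), withSlackPhase_succ]
      field_simp
    rw [convexityMatrix_mulVec, h3, ← Finset.mul_sum]
    simp only [mul_sub, mul_add, Finset.sum_sub_distrib, Finset.sum_add_distrib]
    rw [h2] at h1
    simp only [mul_add] at h1
    linarith
  have hgap0 : ∀ i : Fin n, ∀ k ∈ N.nbr i.succ, 0 ≤ N.Br i.succ k *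
        (√(withSlack u i.succ * withSlack u k - N.flow i.succ k ^ 2) +
          withSlack u i.succ * withSlack u k * (withSlackPhase x i.succ + withSlackPhase x k) /
            (2 * √(withSlack u i.succ * withSlack u k - N.flow i.succ k ^ 2)) -
          √(withSlack v i.succ * withSlack v k - N.flow i.succ k ^ 2)) := by
    intro i k hk
    have h1 := (htan (N.mem_nbr.1 hk)).1
    rw [← hV, ← hV] at h1
    exact mul_nonneg (N.Br_pos (N.mem_nbr.1 hk)).le (sub_nonneg.2 h1)
  have hMle : ∀ i, (N.convexityMatrix u θ *ᵥ x) i ≤ 0 := fun i => by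
    have := Finset.sum_nonneg (hgap0 i)
    linarith [hgap i]
  -- From `x ≥ 0` and `M x ≤ 0` the form is nonpositive at `x`; semidefiniteness makes it zero and
  -- puts `x` in the kernel. All gaps then vanish, so `x` is constant along lines.
  have hMx : N.convexityMatrix u θ *ᵥ x = 0 := by
    refine (hpsd.dotProduct_mulVec_zero_iff x).1 (le_antisymm ?_ ?_)
    · exact Finset.sum_nonpos fun i _ => mul_nonpos_of_nonneg_of_nonpos (hx0 i) (hMle i)
    · exact (posSemidef_iff_dotProduct_mulVec.1 hpsd).2 x
  have heq : ∀ (i : Fin n) k, N.graph.Adj i.succ k →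
      withSlackPhase x i.succ = withSlackPhase x k := by
    intro i k hik
    have h1 := hgap i
    rw [hMx, Pi.zero_apply, zero_div, eq_comm, neg_eq_zero] at h1
    have h2 := (Finset.sum_eq_zero_iff_of_nonneg (hgap0 i)).1 h1 k (N.mem_nbr.2 hik)
    rw [mul_eq_zero, or_iff_right (N.Br_pos hik).ne', sub_eq_zero] at h2
    refine (htan hik).2 ?_
    rw [← hV, ← hV, h2]
  have hzero := N.eq_zero_of_adj_eq (X := withSlackPhase x) rfl (fun i k hik => by
    rcases Fin.eq_zero_or_eq_succ i with rfl | ⟨i, rfl⟩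
    · obtain ⟨k, rfl⟩ := Fin.exists_succ_eq.2 hik.ne'
      exact (heq k 0 hik.symm).symm
    · exact heq i k hik)
  funext i
  have := hV i.succ
  rw [hzero] at this
  simpa using this.symm

variable (N)

/-! ### The energy function in logarithmic variables -/

theorem withSlack_exp (ρ : Fin n → ℝ) (j : Fin (n + 1)) :
    withSlack (fun i => Real.exp (ρ i)) j = Real.exp (withSlackPhase ρ j) := by
  refine Fin.cases ?_ (fun i => ?_) j <;> simp

theorem withSlackPhase_add_smul (x a : Fin n → ℝ) (t : ℝ) (j : Fin (n + 1)) :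
    withSlackPhase (x + t • a) j = withSlackPhase x j + t * withSlackPhase a j := by
  refine Fin.cases ?_ (fun i => ?_) j <;> simp

theorem withSlackPhase_sub (x y : Fin n → ℝ) (j : Fin (n + 1)) :
    withSlackPhase (x - y) j = withSlackPhase x j - withSlackPhase y j := by
  refine Fin.cases ?_ (fun i => ?_) j <;> simp

theorem sqrt_exp_mul_exp (a b : ℝ) : √(Real.exp a * Real.exp b) = Real.exp ((a + b) / 2) := by
  rw [← Real.exp_add, Real.exp_half]

/-- The energy function in the variables `ρ = log v` and `θ`. -/
noncomputable def energyLog (ρ θ : Fin n → ℝ) : ℝ :=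
  1 / 2 * ∑ e ∈ N.lines, N.Br e.1 e.2 *
      (Real.exp (withSlackPhase ρ e.1) + Real.exp (withSlackPhase ρ e.2) -
        2 * Real.exp ((withSlackPhase ρ e.1 + withSlackPhase ρ e.2) / 2) *
        Real.cos (withSlackPhase θ e.1 - withSlackPhase θ e.2))
    - ∑ i, N.pr i * θ i - ∑ i, N.qr i * ρ i / 2

theorem energy_exp (ρ θ : Fin n → ℝ) :
    N.energy (fun i => Real.exp (ρ i)) θ = N.energyLog ρ θ := by
  simp only [energy, energyLog, withSlack_exp, sqrt_exp_mul_exp, Real.log_exp]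

/-- The derivative of the energy in the direction `(a, b)`. -/
noncomputable def energySlope (a b ρ θ : Fin n → ℝ) : ℝ :=
  1 / 2 * ∑ e ∈ N.lines, N.Br e.1 e.2 *
      (withSlackPhase a e.1 * Real.exp (withSlackPhase ρ e.1) +
        withSlackPhase a e.2 * Real.exp (withSlackPhase ρ e.2) -
        Real.exp ((withSlackPhase ρ e.1 + withSlackPhase ρ e.2) / 2) *
        ((withSlackPhase a e.1 + withSlackPhase a e.2) *
            Real.cos (withSlackPhase θ e.1 - withSlackPhase θ e.2) -
          2 * (withSlackPhase b e.1 - withSlackPhase b e.2) *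
            Real.sin (withSlackPhase θ e.1 - withSlackPhase θ e.2)))
    - ∑ i, N.pr i * b i - ∑ i, N.qr i * a i / 2

/-- The second derivative of the energy in the direction `(a, b)`. -/
noncomputable def energyCurvature (a b ρ θ : Fin n → ℝ) : ℝ :=
  1 / 2 * ∑ e ∈ N.lines, N.Br e.1 e.2 *
      (withSlackPhase a e.1 ^ 2 * Real.exp (withSlackPhase ρ e.1) +
        withSlackPhase a e.2 ^ 2 * Real.exp (withSlackPhase ρ e.2) -
        Real.exp ((withSlackPhase ρ e.1 + withSlackPhase ρ e.2) / 2) *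
        (((withSlackPhase a e.1 + withSlackPhase a e.2) ^ 2 / 2 -
            2 * (withSlackPhase b e.1 - withSlackPhase b e.2) ^ 2) *
            Real.cos (withSlackPhase θ e.1 - withSlackPhase θ e.2) -
          2 * (withSlackPhase a e.1 + withSlackPhase a e.2) *
            (withSlackPhase b e.1 - withSlackPhase b e.2) *
            Real.sin (withSlackPhase θ e.1 - withSlackPhase θ e.2)))

theorem hasDerivAt_add_smul (x a : Fin n → ℝ) (j : Fin (n + 1)) (t : ℝ) :
    HasDerivAt (fun t : ℝ => withSlackPhase (x + t • a) j) (withSlackPhase a j) t := by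
  simp only [withSlackPhase_add_smul]
  simpa using ((hasDerivAt_id t).mul_const (withSlackPhase a j)).const_add (withSlackPhase x j)

theorem hasDerivAt_energyLog (ρ θ a b : Fin n → ℝ) (t : ℝ) :
    HasDerivAt (fun t : ℝ => N.energyLog (ρ + t • a) (θ + t • b))
      (N.energySlope a b (ρ + t • a) (θ + t • b)) t := by
  have hρ := fun j => hasDerivAt_add_smul ρ a j t
  have hθ := fun j => hasDerivAt_add_smul θ b j t
  have h1 := (HasDerivAt.fun_sum (u := N.lines) fun e _ =>
    ((((hρ e.1).exp.fun_add (hρ e.2).exp).fun_sub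
      (((((hρ e.1).fun_add (hρ e.2)).div_const 2).exp.const_mul 2).fun_mul
        ((hθ e.1).fun_sub (hθ e.2)).cos)).const_mul (N.Br e.1 e.2))).const_mul (1 / 2 : ℝ)
  have h2 := HasDerivAt.fun_sum (u := Finset.univ) fun i _ => (hθ (Fin.succ i)).const_mul (N.pr i)
  have h3 := HasDerivAt.fun_sum (u := Finset.univ) fun i _ =>
    ((hρ (Fin.succ i)).const_mul (N.qr i)).div_const 2
  refine ((h1.fun_sub h2).fun_sub h3).congr_deriv ?_
  unfold energySlope
  refine congrArg₂ _ (congrArg₂ _ (congrArg _ (Finset.sum_congr rfl fun e _ => ?_)) rfl) rfl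
  ring

theorem hasDerivAt_energySlope (ρ θ a b : Fin n → ℝ) (t : ℝ) :
    HasDerivAt (fun t : ℝ => N.energySlope a b (ρ + t • a) (θ + t • b))
      (N.energyCurvature a b (ρ + t • a) (θ + t • b)) t := by
  have hρ := fun j => hasDerivAt_add_smul ρ a j t
  have hθ := fun j => hasDerivAt_add_smul θ b j t
  have h1 := (HasDerivAt.fun_sum (u := N.lines) fun e _ =>
    (((((hρ e.1).exp.const_mul (withSlackPhase a e.1)).fun_add
      ((hρ e.2).exp.const_mul (withSlackPhase a e.2))).fun_sub
      ((((hρ e.1).fun_add (hρ e.2)).div_const 2).exp.fun_mul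
        ((((hθ e.1).fun_sub (hθ e.2)).cos.const_mul
          (withSlackPhase a e.1 + withSlackPhase a e.2)).fun_sub
        (((hθ e.1).fun_sub (hθ e.2)).sin.const_mul
          (2 * (withSlackPhase b e.1 - withSlackPhase b e.2)))))).const_mul
            (N.Br e.1 e.2))).const_mul (1 / 2 : ℝ)
  refine ((h1.sub_const (∑ i, N.pr i * b i)).sub_const (∑ i, N.qr i * a i / 2)).congr_deriv ?_
  unfold energyCurvature
  refine congrArg _ (Finset.sum_congr rfl fun e _ => ?_)
  ring

theorem differentiable_withSlackPhase (j : Fin (n + 1)) :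
    Differentiable ℝ fun x : Fin n → ℝ => withSlackPhase x j := by
  refine Fin.cases ?_ (fun i => ?_) j
  · simp
  · simp only [withSlackPhase_succ]
    fun_prop

theorem differentiable_energyLog :
    Differentiable ℝ fun z : (Fin n → ℝ) × (Fin n → ℝ) => N.energyLog z.1 z.2 := by
  have h := @differentiable_withSlackPhase n
  have h1 : ∀ j, Differentiable ℝ fun z : (Fin n → ℝ) × (Fin n → ℝ) => withSlackPhase z.1 j :=
    fun j => (h j).comp differentiable_fst
  have h2 : ∀ j, Differentiable ℝ fun z : (Fin n → ℝ) × (Fin n → ℝ) => withSlackPhase z.2 j :=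
    fun j => (h j).comp differentiable_snd
  unfold energyLog
  fun_prop

theorem exp_log_eq {v : Fin n → ℝ} (hv : ∀ i, 0 < v i) :
    (fun i => Real.exp (Real.log (v i))) = v := funext fun i => Real.exp_log (hv i)

theorem isEnergyStationary_iff_slope (v θ : Fin n → ℝ) : N.IsEnergyStationary v θ ↔
      ∀ a b, N.energySlope a b (fun i => Real.log (v i)) θ = 0 := by
  have hline : ∀ a b, HasDerivAt (fun t : ℝ => (fun z : (Fin n → ℝ) × (Fin n → ℝ) =>
      N.energyLog z.1 z.2) (((fun i => Real.log (v i)), θ) + t • (a, b)))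
      (N.energySlope a b (fun i => Real.log (v i)) θ) 0 := by
    intro a b
    have := N.hasDerivAt_energyLog (fun i => Real.log (v i)) θ a b 0
    simpa using this
  unfold IsEnergyStationary
  simp only [energy_exp]
  constructor
  · intro h a b
    exact (hline a b).unique (h.hasLineDerivAt (a, b))
  · intro h
    have hd := (N.differentiable_energyLog (fun i => Real.log (v i), θ)).hasFDerivAt
    convert hd using 1
    symm
    refine ContinuousLinearMap.ext fun ⟨a, b⟩ => ?_
    rw [← (hline a b).unique (hd.hasLineDerivAt (a, b)), h a b]
    rfl

theorem energySlope_log {v : Fin n → ℝ} (hv : ∀ i, 0 < v i) (θ a b : Fin n → ℝ) :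
    N.energySlope a b (fun i => Real.log (v i)) θ =
      ∑ i, (a i / 2 * (N.Btot i.succ * v i - ∑ k ∈ N.nbr i.succ, N.Br i.succ k *
          (√(withSlack v i.succ * withSlack v k) *
            Real.cos (withSlackPhase θ i.succ - withSlackPhase θ k)) - N.qr i) +
        b i * (∑ k ∈ N.nbr i.succ, N.Br i.succ k *
          (√(withSlack v i.succ * withSlack v k) *
            Real.sin (withSlackPhase θ i.succ - withSlackPhase θ k)) - N.pr i)) := by
  have hV : ∀ j, Real.exp (withSlackPhase (fun i => Real.log (v i)) j) = withSlack v j := by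
    intro j
    rw [← withSlack_exp, exp_log_eq hv]
  -- `f i k` is the share of the line charged to bus `i`; it vanishes at the substation, where `a`
  -- and `b` are zero.
  let f : Fin (n + 1) → Fin (n + 1) → ℝ := fun i k => N.Br i k *
    (withSlackPhase a i / 2 * (withSlack v i - √(withSlack v i * withSlack v k) *
        Real.cos (withSlackPhase θ i - withSlackPhase θ k)) +
      withSlackPhase b i * (√(withSlack v i * withSlack v k) *
        Real.sin (withSlackPhase θ i - withSlackPhase θ k)))
  have hlines := N.sum_lines_of_slack (f := f) (fun k => by simp [f])
  have hsum : 1 / 2 * ∑ e ∈ N.lines, N.Br e.1 e.2 *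
      (withSlackPhase a e.1 * withSlack v e.1 + withSlackPhase a e.2 * withSlack v e.2 -
        √(withSlack v e.1 * withSlack v e.2) *
        ((withSlackPhase a e.1 + withSlackPhase a e.2) *
            Real.cos (withSlackPhase θ e.1 - withSlackPhase θ e.2) -
          2 * (withSlackPhase b e.1 - withSlackPhase b e.2) *
            Real.sin (withSlackPhase θ e.1 - withSlackPhase θ e.2))) =
      ∑ i : Fin n, ∑ k ∈ N.nbr i.succ, f i.succ k := by
    rw [Finset.mul_sum]
    refine (Finset.sum_congr rfl fun e he => ?_).trans hlines
    simp only [f]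
    rw [← N.Br_symm (N.mem_lines.1 he).1, mul_comm (withSlack v e.2) (withSlack v e.1),
      ← neg_sub (withSlackPhase θ e.1), Real.cos_neg, Real.sin_neg]
    ring
  unfold energySlope
  simp only [← sqrt_exp_mul_exp, hV]
  rw [hsum, ← Finset.sum_sub_distrib, ← Finset.sum_sub_distrib]
  refine Finset.sum_congr rfl fun i _ => ?_
  simp only [f, withSlack_succ, withSlackPhase_succ, mul_add, mul_sub, Finset.sum_add_distrib,
    Finset.sum_sub_distrib, Btot, Finset.sum_mul, Finset.mul_sum]
  have e2 : ∀ k y, N.Br i.succ k * (a i / 2 * y) = a i / 2 * (N.Br i.succ k * y) :=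
    fun k y => by ring
  have e3 : ∀ k y, N.Br i.succ k * (b i * y) = b i * (N.Br i.succ k * y) :=
    fun k y => by ring
  simp only [e2, e3]
  ring

/-- Stationary points of the energy solve the power flow equations. -/
theorem isEnergyStationary_iff {v : Fin n → ℝ} (hv : ∀ i, 0 < v i) (θ : Fin n → ℝ) :
    N.IsEnergyStationary v θ ↔
      (∀ i : Fin n, ∑ k ∈ N.nbr i.succ, N.Br i.succ k *
          (√(withSlack v i.succ * withSlack v k) *
            Real.sin (withSlackPhase θ i.succ - withSlackPhase θ k)) = N.pr i) ∧
      ∀ i : Fin n, N.Btot i.succ * v i - ∑ k ∈ N.nbr i.succ, N.Br i.succ k *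
          (√(withSlack v i.succ * withSlack v k) *
            Real.cos (withSlackPhase θ i.succ - withSlackPhase θ k)) = N.qr i := by
  rw [isEnergyStationary_iff_slope]
  simp only [N.energySlope_log hv]
  constructor
  · intro h
    refine ⟨fun i => ?_, fun i => ?_⟩
    · have := h 0 (Pi.single i 1)
      simpa [Pi.single_apply, ite_div, sub_eq_zero] using this
    · have := h (Pi.single i 1) 0
      simpa [Pi.single_apply, ite_div, sub_eq_zero] using this
  · rintro ⟨h1, h2⟩ a b
    refine Finset.sum_eq_zero fun i _ => ?_
    rw [h1, h2]
    ring

/-! ### Convexity -/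

/-- Completing the square in the phase increment `b` on each line leaves a quarter of the convexity
form in `a`. -/
theorem le_energyCurvature (a b ρ θ : Fin n → ℝ)
    (hcos : ∀ e ∈ N.lines, 0 < Real.cos (withSlackPhase θ e.1 - withSlackPhase θ e.2)) :
    1 / 4 * (a ⬝ᵥ (N.convexityMatrix (fun i => Real.exp (ρ i)) θ *ᵥ a)) ≤
      N.energyCurvature a b ρ θ := by
  have h1 := N.sum_lines_of_slack (f := fun i k => N.Br i k *
    (Real.exp (withSlackPhase ρ i) * withSlackPhase a i ^ 2)) (fun k => by simp)
  have h2 : ∑ i, N.Btot i.succ * (2 * Real.exp (ρ i)) * a i ^ 2 =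
      ∑ e ∈ N.lines, 2 * (N.Br e.1 e.2 * (withSlackPhase a e.1 ^ 2 *
        Real.exp (withSlackPhase ρ e.1) + withSlackPhase a e.2 ^ 2 *
        Real.exp (withSlackPhase ρ e.2))) := by
    rw [← Finset.mul_sum]
    calc _ = 2 * ∑ i : Fin n, ∑ k ∈ N.nbr i.succ, N.Br i.succ k *
          (Real.exp (withSlackPhase ρ i.succ) * withSlackPhase a i.succ ^ 2) := by
          rw [Finset.mul_sum]
          refine Finset.sum_congr rfl fun i _ => ?_
          rw [← Finset.sum_mul, withSlackPhase_succ, withSlackPhase_succ, Btot]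
          ring
      _ = _ := by
          rw [← h1]
          congr 1
          refine Finset.sum_congr rfl fun e he => ?_
          rw [← N.Br_symm (N.mem_lines.1 he).1]
          ring
  rw [dotProduct_convexityMatrix, h2, ← Finset.sum_sub_distrib, energyCurvature, Finset.mul_sum,
    Finset.mul_sum]
  refine Finset.sum_le_sum fun e he => ?_
  have hB := N.Br_pos (N.mem_lines.1 he).1
  have hc := hcos e he
  rw [lineWeight, withSlack_exp, withSlack_exp, sqrt_exp_mul_exp, ← sub_nonneg]
  set m := Real.exp ((withSlackPhase ρ e.1 + withSlackPhase ρ e.2) / 2) with hm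
  have hmpos : 0 < m := Real.exp_pos _
  have hsc := Real.sin_sq_add_cos_sq (withSlackPhase θ e.1 - withSlackPhase θ e.2)
  set C := Real.cos (withSlackPhase θ e.1 - withSlackPhase θ e.2)
  set S := Real.sin (withSlackPhase θ e.1 - withSlackPhase θ e.2)
  set A := withSlackPhase a e.1 + withSlackPhase a e.2
  set D := withSlackPhase b e.1 - withSlackPhase b e.2
  have key : 0 ≤ N.Br e.1 e.2 * m / C * (D * C + A * S / 2) ^ 2 := by positivity
  refine key.trans (le_of_eq ?_)
  have hS : S ^ 2 = 1 - C ^ 2 := by linarith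
  field_simp
  ring_nf
  rw [hS]
  ring

/-- `exp r / cos φ` is the exponential of `r - log (cos φ)`, which is convex because `cos` is
log-concave on the interval. -/
theorem exp_div_cos_le {r r' φ φ' t : ℝ} (ht0 : 0 ≤ t) (ht1 : t ≤ 1) (hφ : |φ| < Real.pi / 2)
    (hφ' : |φ'| < Real.pi / 2) :
    0 < Real.cos (φ + t * (φ' - φ)) ∧
    Real.exp (r + t * (r' - r)) / Real.cos (φ + t * (φ' - φ)) ≤
      (1 - t) * (Real.exp r / Real.cos φ) + t * (Real.exp r' / Real.cos φ') := by
  have hs := sub_nonneg.2 ht1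
  have hc := Real.cos_pos_of_mem_Ioo (abs_lt.1 hφ)
  have hc' := Real.cos_pos_of_mem_Ioo (abs_lt.1 hφ')
  have hconc := strictConcaveOn_cos_Icc.concaveOn.2 ⟨(abs_lt.1 hφ).1.le, (abs_lt.1 hφ).2.le⟩
    ⟨(abs_lt.1 hφ').1.le, (abs_lt.1 hφ').2.le⟩ hs ht0 (sub_add_cancel 1 t)
  have hlog := strictConcaveOn_log_Ioi.concaveOn.2 (Set.mem_Ioi.2 hc) (Set.mem_Ioi.2 hc') hs ht0
    (sub_add_cancel 1 t)
  simp only [smul_eq_mul] at hconc hlog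
  have e1 : (1 - t) * φ + t * φ' = φ + t * (φ' - φ) := by ring
  rw [e1] at hconc
  have hmid : 0 < (1 - t) * Real.cos φ + t * Real.cos φ' := by
    rcases ht0.eq_or_lt with rfl | ht
    · simpa using hc
    · exact add_pos_of_nonneg_of_pos (mul_nonneg hs hc.le) (mul_pos ht hc')
  have hpos := hmid.trans_le hconc
  refine ⟨hpos, ?_⟩
  have hlog' := hlog.trans (Real.log_le_log hmid hconc)
  have hdiv : ∀ {x y : ℝ}, 0 < Real.cos y →
      Real.exp x / Real.cos y = Real.exp (x - Real.log (Real.cos y)) := fun h => by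
    rw [Real.exp_sub, Real.exp_log h]
  rw [hdiv hc, hdiv hc', hdiv hpos]
  have hexp := convexOn_exp.2 (Set.mem_univ (r - Real.log (Real.cos φ)))
    (Set.mem_univ (r' - Real.log (Real.cos φ'))) hs ht0 (sub_add_cancel 1 t)
  simp only [smul_eq_mul] at hexp
  refine le_trans (Real.exp_le_exp.2 ?_) hexp
  linarith

/-- The quadratic form of the convexity matrix after a diagonal scaling. -/
theorem dotProduct_convexityMatrix_scaled (ρ θ y : Fin n → ℝ) :
    (fun i => y i * Real.exp (-(ρ i) / 2)) ⬝ᵥ (N.convexityMatrix (fun i => Real.exp (ρ i)) θ *ᵥ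
        fun i => y i * Real.exp (-(ρ i) / 2)) =
      ∑ i, N.Btot i.succ * (2 * y i ^ 2) - ∑ e ∈ N.lines, N.Br e.1 e.2 *
        (withSlackPhase y e.1 ^ 2 * (Real.exp ((withSlackPhase ρ e.2 - withSlackPhase ρ e.1) / 2) /
            Real.cos (withSlackPhase θ e.1 - withSlackPhase θ e.2)) +
          2 * (withSlackPhase y e.1 * withSlackPhase y e.2) * (Real.exp 0 /
            Real.cos (withSlackPhase θ e.1 - withSlackPhase θ e.2)) +
          withSlackPhase y e.2 ^ 2 * (Real.exp ((withSlackPhase ρ e.1 - withSlackPhase ρ e.2) / 2) /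
            Real.cos (withSlackPhase θ e.1 - withSlackPhase θ e.2))) := by
  have hX : ∀ j, withSlackPhase (fun i => y i * Real.exp (-(ρ i) / 2)) j =
      withSlackPhase y j * Real.exp (-(withSlackPhase ρ j) / 2) := by
    intro j
    refine Fin.cases ?_ (fun i => ?_) j <;> simp
  have hhalf : ∀ r : ℝ, Real.exp r = Real.exp (r / 2) ^ 2 := fun r => by
    rw [← Real.exp_nat_mul]; congr 1; push_cast; ring
  rw [dotProduct_convexityMatrix]
  congr 1
  · refine Finset.sum_congr rfl fun i _ => ?_
    have h1 : Real.exp (ρ i) * Real.exp (-(ρ i) / 2) ^ 2 = 1 := by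
      rw [hhalf (ρ i), neg_div, Real.exp_neg, ← mul_pow, mul_inv_cancel₀ (Real.exp_pos _).ne',
        one_pow]
    linear_combination (N.Btot i.succ * 2 * y i ^ 2) * h1
  · refine Finset.sum_congr rfl fun e _ => ?_
    rw [hX, hX, lineWeight, withSlack_exp, withSlack_exp, sqrt_exp_mul_exp, add_div, sub_div,
      sub_div, neg_div, neg_div, Real.exp_add, Real.exp_sub, Real.exp_sub, Real.exp_neg,
      Real.exp_neg, Real.exp_zero]
    have h1 := Real.exp_pos (withSlackPhase ρ e.1 / 2)
    have h2 := Real.exp_pos (withSlackPhase ρ e.2 / 2)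
    field_simp
    ring

/-- The convexity domain is convex in the variables `(log v, θ)`. -/
theorem convexityDomain_segment {ρ ρ' θ θ' : Fin n → ℝ}
    (h : ((fun i => Real.exp (ρ i)), θ) ∈ N.convexityDomain)
    (h' : ((fun i => Real.exp (ρ' i)), θ') ∈ N.convexityDomain) {t : ℝ} (ht0 : 0 ≤ t)
    (ht1 : t ≤ 1) :
    (∀ e ∈ N.lines, 0 < Real.cos (withSlackPhase (θ + t • (θ' - θ)) e.1 -
      withSlackPhase (θ + t • (θ' - θ)) e.2)) ∧
    (N.convexityMatrix (fun i => Real.exp ((ρ + t • (ρ' - ρ)) i))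
      (θ + t • (θ' - θ))).PosSemidef := by
  obtain ⟨-, hM, hθ⟩ := h
  obtain ⟨-, hM', hθ'⟩ := h'
  rw [posSemidef_convexityMatrix_iff] at hM hM'
  have hφ : ∀ i k, withSlackPhase (θ + t • (θ' - θ)) i - withSlackPhase (θ + t • (θ' - θ)) k =
      withSlackPhase θ i - withSlackPhase θ k + t * (withSlackPhase θ' i - withSlackPhase θ' k -
        (withSlackPhase θ i - withSlackPhase θ k)) := by
    intro i k
    simp only [withSlackPhase_add_smul, withSlackPhase_sub]
    ring
  have hr : ∀ i k, (withSlackPhase (ρ + t • (ρ' - ρ)) i - withSlackPhase (ρ + t • (ρ' - ρ)) k) / 2 =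
      (withSlackPhase ρ i - withSlackPhase ρ k) / 2 +
        t * ((withSlackPhase ρ' i - withSlackPhase ρ' k) / 2 -
        (withSlackPhase ρ i - withSlackPhase ρ k) / 2) := by
    intro i k
    simp only [withSlackPhase_add_smul, withSlackPhase_sub]
    ring
  have hcos : ∀ e ∈ N.lines, 0 < Real.cos (withSlackPhase (θ + t • (θ' - θ)) e.1 -
      withSlackPhase (θ + t • (θ' - θ)) e.2) := fun e he => by
    rw [hφ]
    exact (exp_div_cos_le (r := 0) (r' := 0) ht0 ht1 (hθ e he) (hθ' e he)).1
  refine ⟨hcos, (N.posSemidef_convexityMatrix_iff _ _).2 fun x => ?_⟩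
  set σ := ρ + t • (ρ' - ρ) with hσ
  -- Passing to `|x|` makes the off-diagonal products nonnegative, so that convexity of the
  -- coefficients can be used.
  refine le_trans ?_ (N.dotProduct_convexityMatrix_abs_le _ _ x fun e he => ?_)
  swap
  · exact (N.lineWeight_pos (fun i => Real.exp_pos _) (N.mem_lines.1 he).1 (hcos e he)).le
  -- In terms of `y` the diagonal part no longer depends on `ρ`, and the line coefficients are the
  -- convex functions of `exp_div_cos_le`. The same `y` serves the endpoints and the intermediate
  -- point.
  set y : Fin n → ℝ := fun i => |x i| * Real.exp (σ i / 2) with hy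
  have hxy : |x| = fun i => y i * Real.exp (-(σ i) / 2) := by
    funext i
    rw [hy, Pi.abs_apply, mul_assoc, ← Real.exp_add]
    ring_nf
    simp
  have hY : ∀ j, 0 ≤ withSlackPhase y j := by
    intro j
    refine Fin.cases le_rfl (fun i => ?_) j
    simp only [withSlackPhase_succ, hy]
    positivity
  have hQ := hM fun i => y i * Real.exp (-(ρ i) / 2)
  have hQ' := hM' fun i => y i * Real.exp (-(ρ' i) / 2)
  simp only [dotProduct_convexityMatrix_scaled] at hQ hQ'
  rw [hxy, dotProduct_convexityMatrix_scaled]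
  have hcomb := add_nonneg (mul_nonneg (sub_nonneg.2 ht1) hQ) (mul_nonneg ht0 hQ')
  refine hcomb.trans ?_
  rw [mul_sub, mul_sub, sub_add_sub_comm, ← add_mul, sub_add_cancel, one_mul]
  refine sub_le_sub_left ?_ _
  rw [Finset.mul_sum, Finset.mul_sum, ← Finset.sum_add_distrib]
  refine Finset.sum_le_sum fun e he => ?_
  have hB := (N.Br_pos (N.mem_lines.1 he).1).le
  have hψ := fun r r' => (exp_div_cos_le (r := r) (r' := r') ht0 ht1 (hθ e he) (hθ' e he)).2
  have h1 := mul_le_mul_of_nonneg_left (hψ ((withSlackPhase ρ e.2 - withSlackPhase ρ e.1) / 2)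
    ((withSlackPhase ρ' e.2 - withSlackPhase ρ' e.1) / 2)) (sq_nonneg (withSlackPhase y e.1))
  have h2 := mul_le_mul_of_nonneg_left (hψ 0 0)
    (mul_nonneg zero_le_two (mul_nonneg (hY e.1) (hY e.2)))
  have h3 := mul_le_mul_of_nonneg_left (hψ ((withSlackPhase ρ e.1 - withSlackPhase ρ e.2) / 2)
    ((withSlackPhase ρ' e.1 - withSlackPhase ρ' e.2) / 2)) (sq_nonneg (withSlackPhase y e.2))
  rw [← hr, ← hφ] at h1 h3
  rw [← hφ, sub_self, mul_zero, add_zero] at h2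
  refine (mul_le_mul_of_nonneg_left (add_le_add (add_le_add h1 h2) h3) hB).trans (le_of_eq ?_)
  ring

/-- A stationary point of the energy in the convexity domain is a minimizer. -/
theorem isMinOn_energy {v θ : Fin n → ℝ} (hdom : (v, θ) ∈ N.convexityDomain)
    (hstat : N.IsEnergyStationary v θ) :
    IsMinOn (fun z => N.energy z.1 z.2) N.convexityDomain (v, θ) := by
  rintro ⟨u, η⟩ hu
  change N.energy v θ ≤ N.energy u η
  set ρ : Fin n → ℝ := fun i => Real.log (v i) with hρ
  set ρ' : Fin n → ℝ := fun i => Real.log (u i) with hρ'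
  have hv : (fun i => Real.exp (ρ i)) = v := exp_log_eq hdom.1
  have hu' : (fun i => Real.exp (ρ' i)) = u := exp_log_eq hu.1
  rw [← hv] at hdom
  rw [← hu'] at hu
  rw [← hv, ← hu', energy_exp, energy_exp]
  have hcurv : ∀ t : ℝ, 0 ≤ t → t ≤ 1 → 0 ≤ N.energyCurvature (ρ' - ρ) (η - θ)
      (ρ + t • (ρ' - ρ)) (θ + t • (η - θ)) := fun t ht0 ht1 => by
    obtain ⟨h1, h2⟩ := N.convexityDomain_segment hdom hu ht0 ht1
    refine le_trans ?_ (N.le_energyCurvature _ _ _ _ h1)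
    exact mul_nonneg (by norm_num) ((N.posSemidef_convexityMatrix_iff _ _).1 h2 _)
  have hslope0 := (N.isEnergyStationary_iff_slope v θ).1 hstat (ρ' - ρ) (η - θ)
  -- Along the segment in `(log v, θ)` the slope starts at zero and does not decrease, hence neither
  -- does the energy.
  have hslope_mono : MonotoneOn (fun t : ℝ => N.energySlope (ρ' - ρ) (η - θ)
      (ρ + t • (ρ' - ρ)) (θ + t • (η - θ))) (Set.Icc 0 1) := by
    refine monotoneOn_of_deriv_nonneg (convex_Icc 0 1)
      (fun t _ => (N.hasDerivAt_energySlope _ _ _ _ t).continuousAt.continuousWithinAt)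
      (fun t _ => (N.hasDerivAt_energySlope _ _ _ _ t).differentiableAt.differentiableWithinAt)
      fun t ht => ?_
    rw [interior_Icc] at ht
    rw [(N.hasDerivAt_energySlope _ _ _ _ t).deriv]
    exact hcurv t ht.1.le ht.2.le
  have hmono : MonotoneOn (fun t : ℝ => N.energyLog
      (ρ + t • (ρ' - ρ)) (θ + t • (η - θ))) (Set.Icc 0 1) := by
    refine monotoneOn_of_deriv_nonneg (convex_Icc 0 1)
      (fun t _ => (N.hasDerivAt_energyLog _ _ _ _ t).continuousAt.continuousWithinAt)
      (fun t _ => (N.hasDerivAt_energyLog _ _ _ _ t).differentiableAt.differentiableWithinAt)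
      fun t ht => ?_
    rw [interior_Icc] at ht
    rw [(N.hasDerivAt_energyLog _ _ _ _ t).deriv]
    have := hslope_mono (Set.left_mem_Icc.2 zero_le_one) ⟨ht.1.le, ht.2.le⟩ ht.1.le
    simp only [zero_smul, add_zero] at this
    exact hslope0.symm.le.trans this
  have := hmono (Set.left_mem_Icc.2 zero_le_one) (Set.right_mem_Icc.2 zero_le_one) zero_le_one
  simpa using this

/-! ### The three approaches -/

/-- The required phase differences are arcsines, antisymmetric in the two ends. A tree has no cycle
condition, so they integrate to phases. -/
theorem exists_phase {v : Fin n → ℝ} (hv : ∀ i, 0 < v i)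
    (hpos : ∀ i k, N.graph.Adj i k → 0 < withSlack v i * withSlack v k - N.flow i k ^ 2) :
    ∃ θ, N.IsCompatible v θ ∧
      (∀ i k, N.graph.Adj i k → |withSlackPhase θ i - withSlackPhase θ k| < Real.pi / 2) ∧
      ∀ i k, N.graph.Adj i k → √(withSlack v i * withSlack v k) *
        Real.sin (withSlackPhase θ i - withSlackPhase θ k) = N.flow i k := by
  obtain ⟨θ, hθ⟩ := N.exists_potential
    (d := fun i k => Real.arcsin (N.flow i k / √(withSlack v i * withSlack v k)))
    (fun i k _ => by
      rw [N.flow_antisymm i k, mul_comm (withSlack v i), neg_div, Real.arcsin_neg])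
  have hvv := fun i k => mul_pos (withSlack_pos hv i) (withSlack_pos hv k)
  have hroot := fun i k => Real.sqrt_pos.2 (hvv i k)
  have hlt : ∀ i k, N.graph.Adj i k → |N.flow i k / √(withSlack v i * withSlack v k)| < 1 := by
    intro i k hik
    rw [abs_div, abs_of_pos (hroot i k), div_lt_one (hroot i k)]
    exact Real.lt_sqrt_of_sq_lt (by rw [sq_abs]; exact sub_pos.1 (hpos i k hik))
  have hpi : ∀ i k, N.graph.Adj i k →
      |withSlackPhase θ i - withSlackPhase θ k| < Real.pi / 2 := by
    intro i k hik
    rw [hθ i k hik, abs_lt]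
    exact ⟨Real.neg_pi_div_two_lt_arcsin.2 (abs_lt.1 (hlt i k hik)).1,
      Real.arcsin_lt_pi_div_two.2 (abs_lt.1 (hlt i k hik)).2⟩
  refine ⟨θ, ⟨hv, fun i k hik => Real.cos_pos_of_mem_Ioo (abs_lt.1 (hpi i k hik)), hpos,
    fun i k hik => ?_⟩, hpi, fun i k hik => ?_⟩
  · rw [hθ i k hik, Real.cos_arcsin, ← Real.sqrt_mul (hvv i k).le, div_pow,
      Real.sq_sqrt (hvv i k).le, mul_sub, mul_one, mul_div_cancel₀ _ (hvv i k).ne']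
  · rw [hθ i k hik, Real.sin_arcsin (abs_lt.1 (hlt i k hik)).1.le (abs_lt.1 (hlt i k hik)).2.le,
      mul_div_cancel₀ _ (hroot i k).ne']

theorem energyComputes_stateOf {v : Fin n → ℝ} (hv : IsGreatest N.relaxFeasible v)
    (hfix : v ∈ N.fixedPoints) : N.EnergyComputes (N.stateOf v) := by
  obtain ⟨θ, hc, hpi, hsin⟩ := N.exists_phase hv.1.1.1 fun i k hik => N.line_slack_pos hv hik
  have hdom : (v, θ) ∈ N.convexityDomain :=
    ⟨hc.pos, hc.posSemidef hv, fun e he => hpi _ _ (N.mem_lines.1 he).1⟩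
  have hstat : N.IsEnergyStationary v θ := by
    refine (N.isEnergyStationary_iff hc.pos θ).2 ⟨fun i => ?_, fun i => ?_⟩
    · rw [← N.flow_spec.2.2 i]
      exact Finset.sum_congr rfl fun k hk => by rw [hsin _ _ (N.mem_nbr.1 hk)]
    · rw [← (N.fixedPoints_iff.1 hfix).2 i, balance]
      congr 1
      exact Finset.sum_congr rfl fun k hk => by rw [hc.mul_cos _ _ (N.mem_nbr.1 hk)]
  refine ⟨θ, hdom, N.isMinOn_energy hdom hstat, hstat, ?_, ?_⟩
  · funext i k
    by_cases hik : N.graph.Adj i k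
    · simp only [stateOf, onLines, if_pos hik, hsin i k hik]
    · simp only [stateOf, onLines, if_neg hik, N.flow_spec.2.1 i k hik]
  · funext i k
    by_cases hik : N.graph.Adj i k
    · simp only [stateOf, onLines, if_pos hik, hc.mul_cos i k hik]
    · simp only [stateOf, onLines, if_neg hik]

theorem EnergyComputes.eq_stateOf {N : RadialNetwork n} {x : PowerFlowState n}
    (hx : N.EnergyComputes x) {v : Fin n → ℝ} (hv : IsGreatest N.relaxFeasible v)
    (hfix : v ∈ N.fixedPoints) : x = N.stateOf v := by
  obtain ⟨θ, ⟨hpos, hpsd, hpi⟩, -, hstat, hs, hc⟩ := hx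
  obtain ⟨hp, hq⟩ := (N.isEnergyStationary_iff hpos θ).1 hstat
  have hcos : ∀ i k, N.graph.Adj i k →
      0 < Real.cos (withSlackPhase θ i - withSlackPhase θ k) := by
    intro i k hik
    rcases N.adj_iff_mem_lines.1 hik with h | h
    · exact Real.cos_pos_of_mem_Ioo (abs_lt.1 (hpi _ h))
    · rw [← Real.cos_neg, neg_sub]
      exact Real.cos_pos_of_mem_Ioo (abs_lt.1 (hpi _ h))
  -- The active half of stationarity and uniqueness of the line flow identify `s`. Then `sin ^ 2 +
  -- cos ^ 2 = 1` recovers `c` as the positive root, so `x.v` is a fixed point.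
  have hflow : x.s = N.flow := by
    refine N.flow_unique ⟨fun i k => ?_, fun i k h => ?_, fun i => ?_⟩
    · by_cases h : N.graph.Adj i k
      · rw [hs, onLines, onLines, if_pos h, if_pos h.symm, mul_comm (withSlack x.v k),
          ← mul_neg, ← Real.sin_neg, neg_sub]
      · rw [hs, onLines, onLines, if_neg h, if_neg (mt SimpleGraph.Adj.symm h), neg_zero]
    · rw [hs, onLines, if_neg h]
    · rw [← hp i]
      exact Finset.sum_congr rfl fun k hk => by rw [hs, onLines, if_pos (N.mem_nbr.1 hk)]
  have hvv := fun i k => mul_pos (withSlack_pos hpos i) (withSlack_pos hpos k)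
  have hslack : ∀ i k, N.graph.Adj i k → withSlack x.v i * withSlack x.v k - N.flow i k ^ 2 =
      (√(withSlack x.v i * withSlack x.v k) *
        Real.cos (withSlackPhase θ i - withSlackPhase θ k)) ^ 2 := by
    intro i k hik
    rw [← hflow, hs, onLines, if_pos hik, mul_pow, mul_pow, Real.sq_sqrt (hvv i k).le,
      Real.sin_sq]
    ring
  have hcompat : N.IsCompatible x.v θ := by
    have hmul := fun i k hik => mul_pos (Real.sqrt_pos.2 (hvv i k)) (hcos i k hik)
    refine ⟨hpos, hcos, fun i k hik => ?_, fun i k hik => ?_⟩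
    · rw [hslack i k hik]
      exact pow_pos (hmul i k hik) 2
    · rw [hslack i k hik, Real.sqrt_sq (hmul i k hik).le]
  have hbal : ∀ i, N.balance x.v i = N.qr i := by
    intro i
    rw [← hq i, balance]
    congr 1
    exact Finset.sum_congr rfl fun k hk => by rw [hcompat.mul_cos _ _ (N.mem_nbr.1 hk)]
  have hle : x.v ≤ v := hv.2 ⟨⟨hpos, fun i k hik => (sub_pos.1 (hcompat.slack_pos i k hik)).le⟩,
    fun i => (hbal i).le⟩
  have hxv := hcompat.eq_of_posSemidef hbal hpsd hle (N.fixedPoints_iff.1 hfix).2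
  subst hxv
  refine PowerFlowState.ext rfl hflow ?_
  funext i k
  by_cases hik : N.graph.Adj i k
  · rw [hc]
    simp only [stateOf, onLines, if_pos hik, hcompat.mul_cos i k hik]
  · rw [hc]
    simp only [stateOf, onLines, if_neg hik]

/-- Feasibility of the relaxation is enough as a starting point, and any power flow solution
supplies it. -/
theorem exists_common_result {w : Fin n → ℝ} (hw : ∀ i, 0 < w i)
    (hne : N.relaxFeasible.Nonempty) :
    ∃ x, N.IsPowerFlowSolution x ∧ IsGreatest N.fixedPoints x.v ∧
      (∀ y, N.RelaxationComputes w y ↔ y = x) ∧ (∀ y, N.EnergyComputes y ↔ y = x) ∧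
      (∀ y, N.FixedPointComputes y ↔ y = x) := by
  obtain ⟨v, hadm, hlim, hv, hfix⟩ := N.exists_isGreatest hne
  refine ⟨N.stateOf v, N.solution_stateOf hfix,
    ⟨hfix, fun u hu => hv.2 (N.fixedPoints_subset hu)⟩, fun y => ⟨?_, ?_⟩,
    fun y => ⟨fun hy => hy.eq_stateOf hv hfix, ?_⟩, fun y => ⟨?_, ?_⟩⟩
  · rintro ⟨hopt, -, -, hy⟩
    rw [hy, (N.isRelaxOptimal_iff hw hv).1 hopt]
  · rintro rfl
    exact ⟨(N.isRelaxOptimal_iff hw hv).2 rfl, fun u => (N.isRelaxOptimal_iff hw hv).1,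
      (N.fixedPoints_iff.1 hfix).2, rfl⟩
  · rintro rfl
    exact N.energyComputes_stateOf hv hfix
  · rintro ⟨-, hlim', -, hy⟩
    rw [hy, tendsto_nhds_unique hlim' hlim]
  · rintro rfl
    exact ⟨hadm, hlim, hfix, rfl⟩

end RadialNetwork

theorem theorem2 (n : ℕ) (N : RadialNetwork n) (w : Fin n → ℝ) (hw : ∀ i, 0 < w i) :
    ((∃ x, N.IsPowerFlowSolution x) ↔
      (N.RelaxationSucceeds w ∧ N.EnergySucceeds ∧ N.FixedPointSucceeds)) ∧
    ((∃ x, N.IsPowerFlowSolution x) →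
      ∃ x, N.IsPowerFlowSolution x ∧ IsGreatest N.fixedPoints x.v ∧
        (∀ y, N.RelaxationComputes w y ↔ y = x) ∧
        (∀ y, N.EnergyComputes y ↔ y = x) ∧
        (∀ y, N.FixedPointComputes y ↔ y = x)) := by
  refine ⟨⟨?_, ?_⟩, ?_⟩
  · rintro ⟨x, hx⟩
    obtain ⟨y, -, -, hR, hE, hF⟩ := N.exists_common_result hw ⟨_, N.relaxFeasible_of_solution hx⟩
    exact ⟨⟨y, (hR y).2 rfl⟩, ⟨y, (hE y).2 rfl⟩, ⟨y, (hF y).2 rfl⟩⟩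
  -- For the converse the limit of the iteration suffices: a fixed point of `g` yields a solution.
  · rintro ⟨-, -, x, -, -, hx, -⟩
    exact ⟨_, N.solution_stateOf hx⟩
  · rintro ⟨x, hx⟩
    exact N.exists_common_result hw ⟨_, N.relaxFeasible_of_solution hx⟩
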